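/- For $n\ge 0$ let $(a)_n=a(a+1)\cdots(a+n-1)$ (with $(a)_0=1$), and let $${}_3F_2\biggl(\begin{matrix}a_0,a_1,a_2\\ b_1,b_2\end{matrix};x\biggr)=\sum_{n=0}^\infty\frac{(a_0)_n(a_1)_n(a_2)_n}{n!\,(b_1)_n(b_2)_n}\,x^n .$$ For $(\ell,s,C)=(1,\tfrac16,432),\ (2,\tfrac14,64),\ (3,\tfrac13,27),\ (4,\tfrac12,16)$ put $$F_\ell(x)={}_3F_2\biggl(\begin{matrix}\tfrac12,\,s,\,1-s\\ 1,\,1\end{matrix};4Cx\biggr).$$ For parameters $(\alpha,\beta,\gamma)$ let the sequences $t(n)$ and $T(n)$ be determined by $t(0)=T(0)=1$ and, for all integers $n\ge0$ (the last terms being $0$ when $n=0$), $$(n+1)^2t(n+1)=(\alpha n^2+\alpha n+\beta)\,t(n)+\gamma n^2\,t(n-1),$$ $$(n+1)^3T(n+1)=-(2n+1)(\alpha n^2+\alpha n+\alpha-2\beta)\,T(n)-(\alpha^2+4\gamma)n^3\,T(n-1),$$ and put $$F(x)=\sum_{n=0}^\infty\binom{2n}{n}t(n)x^n,\qquad G(x)=\sum_{n=0}^\infty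 T(n)x^n .$$ Let $F_{6a},G_{6a}$ be the functions $F,G$ for $(\alpha,\beta,\gamma)=(-17,-6,-72)$, let $F_{6b},G_{6b}$ be those for $(10,3,-9)$, and let $F_{6c},G_{6c}$ be those for $(7,2,8)$. Then for all complex $p$ in some neighbourhood of $0$ the power series in each of the following forty-two expressions converges absolutely at the indicated argument, and the forty-two expressions (with principal branches of the fractional powers) are all equal. Level 1: (1) $\displaystyle \frac{1}{(1 +4p -8p^2 ) ^{1/2}(1 +228p-408p^2 -128p^3 -192p^4+768p^5-512p^6) ^{1/2}} F_1 \biggl(\frac{p( 1-p)^3 ( 1-4p) ^{12} ( 1-2p)( 1+2p)^3 }{ (1 +4p -8p^2 )^3 (1 +228p-408p^2 -128p^3 -192p^4+768p^5-512p^6)^3}\biggr)$ (2) $\displaystyle \frac{1}{(1 -2p + 4p^2) ^{1/2}(1 -6p +240p^2-920p^3+960p^4-96p^5 +64p^6) ^{1/2}} F_1 \biggl(\frac{p^2 ( 1-p )^6 ( 1-4p )^6( 1-2p )^2 ( 1+2p )^6} { (1 -2p + 4p^2)^3 (1 -6p +240p^2-920p^3+960p^4-96p^5 +64p^6)^3}\biggr)$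 (3) $\displaystyle \frac{1}{(1+4p -8p^2 ) ^{1/2} (1 -12p +72p^2-128p^3-192p^4+768p^5-512p^6 ) ^{1/2}} F_1 \biggl(\frac{p^3 ( 1-p ) ( 1-4p )^4 ( 1-2p )^3 ( 1+2p ) } { (1+4p -8p^2 )^3 (1 -12p +72p^2-128p^3-192p^4+768p^5-512p^6 )^3}\biggr)$ (4) $\displaystyle \frac{1}{(1-2p -2p^2 ) ^{1/2}(1-6p +6p^2+16p^3+204p^4-456p^5-8p^6) ^{1/2}} F_1 \biggl(\frac{p^4 ( 1-p ) ^{12} ( 1-4p )^3 ( 1-2p ) ( 1+2p )^3}{ (1-2p -2p^2 )^3(1-6p +6p^2+16p^3+204p^4-456p^5-8p^6)^3}\biggr)$ (5) $\displaystyle \frac{1}{(1-2p+ 4p^2 ) ^{1/2}( 1-6p+40p^3-96p^5 +64p^6) ^{1/2}} F_1 \biggl(\frac{p^6 ( 1-p )^2 ( 1-4p )^2 ( 1-2p )^6 ( 1+2p )^2}{ (1-2p+ 4p^2 )^3( 1-6p+40p^3-96p^5 +64p^6)^3 }\biggr)$ (6) $\displaystyle \frac{1}{(1-2p -2p^2 )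 ^{1/2} (1-6p +6p^2+16p^3-36p^4+24p^5 -8p^6) ^{1/2}} F_1 \biggl(\frac{p^{12} ( 1-p )^4 ( 1-4p ) ( 1-2p )^3 ( 1+2p ) } { (1-2p -2p^2 )^3 (1-6p +6p^2+16p^3-36p^4+24p^5 -8p^6)^3}\biggr)$ (7) $\displaystyle \frac{1}{(1 -8p +4p^2 ) ^{1/2} (1 -240p +1932p^2 -5888p^3 +7728p^4-3840p^5+64p^6) ^{1/2}} F_1 \biggl(\frac{-p ( 1-p )^3 ( 1-4p )^3 ( 1-2p )^4 ( 1+2p ) ^{12}} { (1 -8p +4p^2 )^3 (1 -240p +1932p^2 -5888p^3 +7728p^4-3840p^5+64p^6)^3}\biggr)$ (8) $\displaystyle \frac{1}{(1 -8p +4p^2 ) ^{1/2} (1 +12p^2 -128p^3 +48p^4+64p^6) ^{1/2}} F_1 \biggl(\frac{-p^3 ( 1-p ) ( 1-4p ) ( 1-2p )^{12} ( 1+2p )^4} { (1 -8p +4p^2 )^3 (1 +12p^2 -128p^3 +48p^4+64p^6)^3}\biggr)$ Level 2: (9) $\displaystyle \frac{1}{1+20p-48p^2+32p^3-32p^4}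 F_2 \biggl(\frac{p ( 1-p )^3 ( 1-4p )^6 ( 1-2p ) ( 1+2p )^3} { (1 +20p -48p^2 +32p^3-32p^4)^4}\biggr)$ (10) $\displaystyle \frac{1}{1-4p+24p^2-40p^3 -8p^4} F_2 \biggl(\frac{p^2 ( 1-p )^6 ( 1-4p )^3 ( 1-2p ) ( 1+2p )^3}{ ( 1-4p+24p^2 -40p^3 -8p^4)^4}\biggr)$ (11) $\displaystyle \frac{1}{1-4p+32p^3-32p^4} F_2 \biggl(\frac{p^3 ( 1-p ) ( 1-4p )^2 ( 1-2p )^3 ( 1+2p ) } { (1 -4p +32p^3-32p^4 )^4}\biggr)$ (12) $\displaystyle \frac{1}{1-4p+8p^3-8p^4} F_2 \biggl(\frac{p^6 ( 1-p )^2 ( 1-4p ) ( 1-2p )^3 ( 1+2p ) } { (1-4p +8p^3 -8p^4 )^4}\biggr)$ (13) $\displaystyle \frac{1}{1-28p+96p^2-112p^3+16p^4} F_2 \biggl(-\frac{p ( 1-p )^3 ( 1-4p )^3 ( 1-2p )^2 ( 1+2p )^6} { (1 -28p +96p^2 -112p^3+16p^4)^4}\biggr)$ (14) $\displaystyle \frac{1}{1-4p-16p^3+16p^4}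 F_2 \biggl(-\frac{p^3 ( 1-p ) ( 1-4p ) ( 1-2p )^6 ( 1+2p )^2} { (1 -4p -16p^3+16p^4)^4}\biggr)$ Level 3: (15) $\displaystyle \frac{1}{(1+4p-8p^2)^2} F_3 \biggl(\frac{p ( 1-p ) ( 1-4p )^4 ( 1-4p^2 ) }{ ( 1+4p-8p^2 )^6}\biggr)$ (16) $\displaystyle \frac{1}{(1-2p+4p^2)^2} F_3 \biggl(\frac{p^2 ( 1-p )^2 ( 1-4p )^2 ( 1-4p^2 )^2}{ ( 1-2p+4p^2 )^6}\biggr)$ (17) $\displaystyle \frac{1}{(1-2p-2p^2)^2 } F_3 \biggl(\frac{p^4 ( 1-p )^4 ( 1-4p ) ( 1-4p^2 ) }{ ( 1-2p-2p^2 )^6}\biggr)$ (18) $\displaystyle \frac{1}{(1-8p+4p^2)^2 } F_3 \biggl(-\frac{p ( 1-p ) ( 1-4p ) ( 1-4p^2 )^4 }{ ( 1-8p+4p^2 )^6}\biggr)$ Level 4: (19) $\displaystyle \frac{1}{ ( 1-2p ) ( 1+2p )^3} F_4 \biggl(\frac{p ( 1-p )^3 ( 1-4p )^3}{ ( 1-2p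 )^2 ( 1+2p )^6}\biggr)$ (20) $\displaystyle \frac{1}{ ( 1-2p )^3 ( 1+2p ) } F_4 \biggl(\frac{p^3 ( 1-p ) ( 1-4p ) }{ ( 1-2p )^6 ( 1+2p )^2}\biggr)$ (21) $\displaystyle \frac{1}{ ( 1-4p )^3 } F_4 \biggl(-\frac{p ( 1-2p )(1+2p)^3(1-p)^3 }{( 1-4p )^6}\biggr)$ (22) $\displaystyle \frac{1}{ ( 1-4p ) } F_4 \biggl(-\frac{{p^3} ( 1-2p )^3(1+2p)(1-p) }{( 1-4p )^2}\biggr)$ (23) $\displaystyle \frac{1}{(1-2p)^{1/2}(1+2p)^{3/2} ( 1-4p ) ^{3/2} } F_4 \biggl(-\frac{p^2 ( 1-p )^6}{(1-2p)(1+2p)^3 ( 1-4p )^3}\biggr)$ (24) $\displaystyle \frac{1}{(1-2p)^{3/2}(1+2p)^{1/2} ( 1-4p ) ^{1/2} } F_4 \biggl(-\frac{p^6( 1-p )^2}{(1-2p)^3(1+2p) ( 1-4p )}\biggr)$ Level 6, functions $F$: (25) $\displaystyle \frac{1}{1-16p+24p^2+32p^3-32p^4} F_{6a} \biggl(\frac{p(1-p)(1-4p)^2(1-2p)(1+2p)}{(1-16p+24p^2+32p^3-32p^4)^2}\biggr)$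 (26) $\displaystyle \frac{1}{1-4p-12p^2+32p^3-8p^4} F_{6a} \biggl(\frac{p^2(1-p)^2(1-4p)(1-2p)(1+2p)}{(1-4p-12p^2+32p^3-8p^4)^2}\biggr)$ (27) $\displaystyle \frac{1}{1+8p-48p^2+32p^3+16p^4} F_{6a} \biggl(\frac{-p(1-p)(1-4p)(1-2p)^2(1+2p)^2}{(1+8p-48p^2+32p^3+16p^4)^2}\biggr)$ (28) $\displaystyle \frac{1}{(1-2p+4p^2)(1+4p-8p^2)} F_{6b} \biggl(\frac{p(1-p)(1-4p)^2(1-2p)(1+2p)}{(1-2p+4p^2)^2(1+4p-8p^2)^2}\biggr)$ (29) $\displaystyle \frac{1}{(1-2p-2p^2)(1-2p+4p^2)} F_{6b} \biggl(\frac{p^2(1-p)^2(1-4p)(1-2p)(1+2p)}{(1-2p-2p^2)^2(1-2p+4p^2)^2}\biggr)$ (30) $\displaystyle \frac{1}{(1-2p+4p^2)(1-8p+4p^2)} F_{6b} \biggl(\frac{-p(1-p)(1-4p)(1-2p)^2(1+2p)^2}{(1-2p+4p^2)^2(1-8p+4p^2)^2}\biggr)$ (31) $\displaystyle \frac{1}{1+8p^2-32p^3+32p^4}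 F_{6c} \biggl(\frac{p(1-p)(1-4p)^2(1-2p)(1+2p)}{(1+8p^2-32p^3+32p^4)^2}\biggr)$ (32) $\displaystyle \frac{1}{1-4p+4p^2+8p^4} F_{6c} \biggl(\frac{p^2(1-p)^2(1-4p)(1-2p)(1+2p)}{(1-4p+4p^2+8p^4)^2}\biggr)$ (33) $\displaystyle \frac{1}{1-8p+32p^2-32p^3+16p^4} F_{6c} \biggl(\frac{-p(1-p)(1-4p)(1-2p)^2(1+2p)^2}{(1-8p+32p^2-32p^3+16p^4)^2}\biggr)$ Level 6, functions $G$: (34) $\displaystyle \frac{1}{(1+2p)(1-p)} G_{6a} \biggl(\frac{p(1-4p)^2(1-2p)}{(1+2p)(1-p)}\biggr)$ (35) $\displaystyle \frac{1}{(1-2p)(1-p)^2} G_{6a} \biggl(\frac{p^2(1+2p)(1-4p)}{(1-2p)(1-p)^2}\biggr)$ (36) $\displaystyle \frac{1}{(1-p)(1-4p)(1-2p)^2} G_{6a} \biggl(\frac{-p(1+2p)^2}{(1-p)(1-4p)(1-2p)^2}\biggr)$ (37) $\displaystyle \frac{1}{(1-4p)^2} G_{6b} \biggl(\frac{p(1+2p)(1-2p)(1-p)}{(1-4p)^2}\biggr)$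 (38) $\displaystyle \frac{1}{(1-2p)(1+2p)(1-4p)} G_{6b} \biggl(\frac{p^2(1-p)^2}{(1-2p)(1+2p)(1-4p)}\biggr)$ (39) $\displaystyle \frac{1}{(1-2p)^2(1+2p)^2} G_{6b} \biggl(\frac{-p(1-p)(1-4p)}{(1-2p)^2(1+2p)^2}\biggr)$ (40) $\displaystyle \frac{1}{(1-p)(1+2p)(1-4p)^2} G_{6c} \biggl(\frac{p(1-2p)}{(1-p)(1+2p)(1-4p)^2}\biggr)$ (41) $\displaystyle \frac{1}{(1+2p)(1-p)^2(1-4p)} G_{6c} \biggl(\frac{p^2(1-2p)}{(1+2p)(1-p)^2(1-4p)}\biggr)$ (42) $\displaystyle \frac{1}{(1-p)(1-4p)(1+2p)^2} G_{6c} \biggl(\frac{-p(1-2p)^2}{(1-p)(1-4p)(1+2p)^2}\biggr)$ -/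

import Mathlib

/-! Everything is over `ℂ`; non-integral powers are principal branches. -/

namespace FortyTwo

open scoped Nat

noncomputable section

/-- The Pochhammer symbol `(a)ₙ = a (a + 1) ⋯ (a + n - 1)`. -/
def poch (a : ℂ) (n : ℕ) : ℂ := (ascPochhammer ℂ n).eval a

/-- The coefficient of `x ^ n` in the hypergeometric series `₃F₂(a₀, a₁, a₂; b₁, b₂; x)`. -/
def hyp32Coeff (a₀ a₁ a₂ b₁ b₂ : ℂ) (n : ℕ) : ℂ :=
  (poch a₀ n * poch a₁ n * poch a₂ n) / ((n ! : ℂ) * poch b₁ n * poch b₂ n)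

/-- The hypergeometric function `₃F₂(a₀, a₁, a₂; b₁, b₂; x)` as the sum of its series. -/
def hyp32 (a₀ a₁ a₂ b₁ b₂ x : ℂ) : ℂ := ∑' n : ℕ, hyp32Coeff a₀ a₁ a₂ b₁ b₂ n * x ^ n

/-- The function `x ↦ ∑ₙ c n * x ^ n`. -/
def genFun (c : ℕ → ℂ) (x : ℂ) : ℂ := ∑' n : ℕ, c n * x ^ n

/-- The coefficients, in powers of `x`, of `₃F₂(1/2, s, 1 - s; 1, 1; 4 C x)`. -/
def hypCoeff (s C : ℂ) (n : ℕ) : ℂ := hyp32Coeff (1 / 2) s (1 - s) 1 1 n * (4 * C) ^ n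

theorem genFun_hypCoeff (s C x : ℂ) :
    genFun (hypCoeff s C) x = hyp32 (1 / 2) s (1 - s) 1 1 (4 * C * x) := by
  unfold genFun hyp32 hypCoeff
  congr 1
  funext n
  rw [mul_pow (4 * C) x n, mul_assoc]

/-- The sequence `t(n)` attached to `(α, β, γ)`; see `t_zero` and `t_rec`. -/
def t (α β γ : ℂ) : ℕ → ℂ
  | 0 => 1
  | 1 => β
  | n + 2 =>
    ((α * ((n : ℂ) + 1) ^ 2 + α * ((n : ℂ) + 1) + β) * t α β γ (n + 1)
      + γ * ((n : ℂ) + 1) ^ 2 * t α β γ n) / ((n : ℂ) + 2) ^ 2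

/-- The sequence `T(n)` attached to `(α, β, γ)`; see `T_zero` and `T_rec`. -/
def T (α β γ : ℂ) : ℕ → ℂ
  | 0 => 1
  | 1 => -(α - 2 * β)
  | n + 2 =>
    (-(2 * ((n : ℂ) + 1) + 1) *
          (α * ((n : ℂ) + 1) ^ 2 + α * ((n : ℂ) + 1) + α - 2 * β) * T α β γ (n + 1)
      - (α ^ 2 + 4 * γ) * ((n : ℂ) + 1) ^ 3 * T α β γ n) / ((n : ℂ) + 2) ^ 3

theorem t_zero (α β γ : ℂ) : t α β γ 0 = 1 := by simp [t]

theorem T_zero (α β γ : ℂ) : T α β γ 0 = 1 := by simp [T]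

/-- The recurrence for `t`; at `n = 0` the last term vanishes. -/
theorem t_rec (α β γ : ℂ) (n : ℕ) :
    ((n : ℂ) + 1) ^ 2 * t α β γ (n + 1)
      = (α * (n : ℂ) ^ 2 + α * n + β) * t α β γ n + γ * (n : ℂ) ^ 2 * t α β γ (n - 1) := by
  cases n with
  | zero => simp [t]
  | succ n =>
    have h : ((n : ℂ) + 2) ≠ 0 := by exact_mod_cast Nat.succ_ne_zero (n + 1)
    simp only [t, Nat.add_sub_cancel]
    push_cast
    field_simp
    ring

/-- The recurrence for `T`; at `n = 0` the last term vanishes. -/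
theorem T_rec (α β γ : ℂ) (n : ℕ) :
    ((n : ℂ) + 1) ^ 3 * T α β γ (n + 1)
      = -(2 * (n : ℂ) + 1) * (α * (n : ℂ) ^ 2 + α * n + α - 2 * β) * T α β γ n
        - (α ^ 2 + 4 * γ) * (n : ℂ) ^ 3 * T α β γ (n - 1) := by
  cases n with
  | zero => simp [T]
  | succ n =>
    have h : ((n : ℂ) + 2) ≠ 0 := by exact_mod_cast Nat.succ_ne_zero (n + 1)
    simp only [T, Nat.add_sub_cancel]
    push_cast
    field_simp
    ring

/-- The coefficients of `F(x) = ∑ₙ (2n choose n) t(n) xⁿ`. -/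
def aperyF (α β γ : ℂ) (n : ℕ) : ℂ := ((2 * n).choose n : ℂ) * t α β γ n

/-- The coefficients of `G(x) = ∑ₙ T(n) xⁿ`. -/
def aperyG (α β γ : ℂ) (n : ℕ) : ℂ := T α β γ n

/-- Coefficients of `F1`. -/
def coeffF1 : ℕ → ℂ := hypCoeff (1 / 6) 432

/-- Coefficients of `F2`. -/
def coeffF2 : ℕ → ℂ := hypCoeff (1 / 4) 64

/-- Coefficients of `F3`. -/
def coeffF3 : ℕ → ℂ := hypCoeff (1 / 3) 27

/-- Coefficients of `F4`. -/
def coeffF4 : ℕ → ℂ := hypCoeff (1 / 2) 16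

/-- Coefficients of `F6a`. -/
def coeffF6a : ℕ → ℂ := aperyF (-17) (-6) (-72)

/-- Coefficients of `G6a`. -/
def coeffG6a : ℕ → ℂ := aperyG (-17) (-6) (-72)

/-- Coefficients of `F6b`. -/
def coeffF6b : ℕ → ℂ := aperyF 10 3 (-9)

/-- Coefficients of `G6b`. -/
def coeffG6b : ℕ → ℂ := aperyG 10 3 (-9)

/-- Coefficients of `F6c`. -/
def coeffF6c : ℕ → ℂ := aperyF 7 2 8

/-- Coefficients of `G6c`. -/
def coeffG6c : ℕ → ℂ := aperyG 7 2 8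

/-- An expression `r(p) * Φ(x(p))` in `p`, where `Φ(x) = ∑ₙ c n * x ^ n`. -/
structure Expression where
  /-- the prefactor `r(p)` -/
  prefactor : ℂ → ℂ
  /-- the coefficients `c n` of `Φ` -/
  coeff : ℕ → ℂ
  /-- the argument `x(p)` -/
  arg : ℂ → ℂ

/-- The value `r(p) * Φ(x(p))`. -/
def Expression.value (e : Expression) (p : ℂ) : ℂ := e.prefactor p * genFun e.coeff (e.arg p)

/-- The series `Φ` converges (absolutely) at `x(p)`. -/
def Expression.Converges (e : Expression) (p : ℂ) : Prop :=
  Summable fun n : ℕ => e.coeff n * e.arg p ^ n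

/-- Level 1, with `F₁`. -/
def level1 : List Expression :=
  [⟨fun p => 1 / ((1 + 4 * p - 8 * p ^ 2) ^ (1 / 2 : ℂ) * (1 + 228 * p - 408 * p ^ 2 - 128 * p ^ 3 - 192 * p ^ 4 + 768 * p ^ 5 - 512 * p ^ 6) ^ (1 / 2 : ℂ)),
      coeffF1,
      fun p => (p * (1 - p) ^ 3 * (1 - 4 * p) ^ 12 * (1 - 2 * p) * (1 + 2 * p) ^ 3)
        / ((1 + 4 * p - 8 * p ^ 2) ^ 3 * (1 + 228 * p - 408 * p ^ 2 - 128 * p ^ 3 - 192 * p ^ 4 + 768 * p ^ 5 - 512 * p ^ 6) ^ 3)⟩,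
    ⟨fun p => 1 / ((1 - 2 * p + 4 * p ^ 2) ^ (1 / 2 : ℂ) * (1 - 6 * p + 240 * p ^ 2 - 920 * p ^ 3 + 960 * p ^ 4 - 96 * p ^ 5 + 64 * p ^ 6) ^ (1 / 2 : ℂ)),
      coeffF1,
      fun p => (p ^ 2 * (1 - p) ^ 6 * (1 - 4 * p) ^ 6 * (1 - 2 * p) ^ 2 * (1 + 2 * p) ^ 6)
        / ((1 - 2 * p + 4 * p ^ 2) ^ 3 * (1 - 6 * p + 240 * p ^ 2 - 920 * p ^ 3 + 960 * p ^ 4 - 96 * p ^ 5 + 64 * p ^ 6) ^ 3)⟩,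
    ⟨fun p => 1 / ((1 + 4 * p - 8 * p ^ 2) ^ (1 / 2 : ℂ) * (1 - 12 * p + 72 * p ^ 2 - 128 * p ^ 3 - 192 * p ^ 4 + 768 * p ^ 5 - 512 * p ^ 6) ^ (1 / 2 : ℂ)),
      coeffF1,
      fun p => (p ^ 3 * (1 - p) * (1 - 4 * p) ^ 4 * (1 - 2 * p) ^ 3 * (1 + 2 * p))
        / ((1 + 4 * p - 8 * p ^ 2) ^ 3 * (1 - 12 * p + 72 * p ^ 2 - 128 * p ^ 3 - 192 * p ^ 4 + 768 * p ^ 5 - 512 * p ^ 6) ^ 3)⟩,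
    ⟨fun p => 1 / ((1 - 2 * p - 2 * p ^ 2) ^ (1 / 2 : ℂ) * (1 - 6 * p + 6 * p ^ 2 + 16 * p ^ 3 + 204 * p ^ 4 - 456 * p ^ 5 - 8 * p ^ 6) ^ (1 / 2 : ℂ)),
      coeffF1,
      fun p => (p ^ 4 * (1 - p) ^ 12 * (1 - 4 * p) ^ 3 * (1 - 2 * p) * (1 + 2 * p) ^ 3)
        / ((1 - 2 * p - 2 * p ^ 2) ^ 3 * (1 - 6 * p + 6 * p ^ 2 + 16 * p ^ 3 + 204 * p ^ 4 - 456 * p ^ 5 - 8 * p ^ 6) ^ 3)⟩,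
    ⟨fun p => 1 / ((1 - 2 * p + 4 * p ^ 2) ^ (1 / 2 : ℂ) * (1 - 6 * p + 40 * p ^ 3 - 96 * p ^ 5 + 64 * p ^ 6) ^ (1 / 2 : ℂ)),
      coeffF1,
      fun p => (p ^ 6 * (1 - p) ^ 2 * (1 - 4 * p) ^ 2 * (1 - 2 * p) ^ 6 * (1 + 2 * p) ^ 2)
        / ((1 - 2 * p + 4 * p ^ 2) ^ 3 * (1 - 6 * p + 40 * p ^ 3 - 96 * p ^ 5 + 64 * p ^ 6) ^ 3)⟩,
    ⟨fun p => 1 / ((1 - 2 * p - 2 * p ^ 2) ^ (1 / 2 : ℂ) * (1 - 6 * p + 6 * p ^ 2 + 16 * p ^ 3 - 36 * p ^ 4 + 24 * p ^ 5 - 8 * p ^ 6) ^ (1 / 2 : ℂ)),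
      coeffF1,
      fun p => (p ^ 12 * (1 - p) ^ 4 * (1 - 4 * p) * (1 - 2 * p) ^ 3 * (1 + 2 * p))
        / ((1 - 2 * p - 2 * p ^ 2) ^ 3 * (1 - 6 * p + 6 * p ^ 2 + 16 * p ^ 3 - 36 * p ^ 4 + 24 * p ^ 5 - 8 * p ^ 6) ^ 3)⟩,
    ⟨fun p => 1 / ((1 - 8 * p + 4 * p ^ 2) ^ (1 / 2 : ℂ) * (1 - 240 * p + 1932 * p ^ 2 - 5888 * p ^ 3 + 7728 * p ^ 4 - 3840 * p ^ 5 + 64 * p ^ 6) ^ (1 / 2 : ℂ)),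
      coeffF1,
      fun p => (-p * (1 - p) ^ 3 * (1 - 4 * p) ^ 3 * (1 - 2 * p) ^ 4 * (1 + 2 * p) ^ 12)
        / ((1 - 8 * p + 4 * p ^ 2) ^ 3 * (1 - 240 * p + 1932 * p ^ 2 - 5888 * p ^ 3 + 7728 * p ^ 4 - 3840 * p ^ 5 + 64 * p ^ 6) ^ 3)⟩,
    ⟨fun p => 1 / ((1 - 8 * p + 4 * p ^ 2) ^ (1 / 2 : ℂ) * (1 + 12 * p ^ 2 - 128 * p ^ 3 + 48 * p ^ 4 + 64 * p ^ 6) ^ (1 / 2 : ℂ)),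
      coeffF1,
      fun p => (-p ^ 3 * (1 - p) * (1 - 4 * p) * (1 - 2 * p) ^ 12 * (1 + 2 * p) ^ 4)
        / ((1 - 8 * p + 4 * p ^ 2) ^ 3 * (1 + 12 * p ^ 2 - 128 * p ^ 3 + 48 * p ^ 4 + 64 * p ^ 6) ^ 3)⟩]

/-- Level 2, with `F₂`. -/
def level2 : List Expression :=
  [⟨fun p => 1 / (1 + 20 * p - 48 * p ^ 2 + 32 * p ^ 3 - 32 * p ^ 4),
      coeffF2,
      fun p => (p * (1 - p) ^ 3 * (1 - 4 * p) ^ 6 * (1 - 2 * p) * (1 + 2 * p) ^ 3)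
        / ((1 + 20 * p - 48 * p ^ 2 + 32 * p ^ 3 - 32 * p ^ 4) ^ 4)⟩,
    ⟨fun p => 1 / (1 - 4 * p + 24 * p ^ 2 - 40 * p ^ 3 - 8 * p ^ 4),
      coeffF2,
      fun p => (p ^ 2 * (1 - p) ^ 6 * (1 - 4 * p) ^ 3 * (1 - 2 * p) * (1 + 2 * p) ^ 3)
        / ((1 - 4 * p + 24 * p ^ 2 - 40 * p ^ 3 - 8 * p ^ 4) ^ 4)⟩,
    ⟨fun p => 1 / (1 - 4 * p + 32 * p ^ 3 - 32 * p ^ 4),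
      coeffF2,
      fun p => (p ^ 3 * (1 - p) * (1 - 4 * p) ^ 2 * (1 - 2 * p) ^ 3 * (1 + 2 * p))
        / ((1 - 4 * p + 32 * p ^ 3 - 32 * p ^ 4) ^ 4)⟩,
    ⟨fun p => 1 / (1 - 4 * p + 8 * p ^ 3 - 8 * p ^ 4),
      coeffF2,
      fun p => (p ^ 6 * (1 - p) ^ 2 * (1 - 4 * p) * (1 - 2 * p) ^ 3 * (1 + 2 * p))
        / ((1 - 4 * p + 8 * p ^ 3 - 8 * p ^ 4) ^ 4)⟩,
    ⟨fun p => 1 / (1 - 28 * p + 96 * p ^ 2 - 112 * p ^ 3 + 16 * p ^ 4),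
      coeffF2,
      fun p => -(p * (1 - p) ^ 3 * (1 - 4 * p) ^ 3 * (1 - 2 * p) ^ 2 * (1 + 2 * p) ^ 6)
        / ((1 - 28 * p + 96 * p ^ 2 - 112 * p ^ 3 + 16 * p ^ 4) ^ 4)⟩,
    ⟨fun p => 1 / (1 - 4 * p - 16 * p ^ 3 + 16 * p ^ 4),
      coeffF2,
      fun p => -(p ^ 3 * (1 - p) * (1 - 4 * p) * (1 - 2 * p) ^ 6 * (1 + 2 * p) ^ 2)
        / ((1 - 4 * p - 16 * p ^ 3 + 16 * p ^ 4) ^ 4)⟩]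

/-- Level 3, with `F₃`. -/
def level3 : List Expression :=
  [⟨fun p => 1 / ((1 + 4 * p - 8 * p ^ 2) ^ 2),
      coeffF3,
      fun p => (p * (1 - p) * (1 - 4 * p) ^ 4 * (1 - 4 * p ^ 2))
        / ((1 + 4 * p - 8 * p ^ 2) ^ 6)⟩,
    ⟨fun p => 1 / ((1 - 2 * p + 4 * p ^ 2) ^ 2),
      coeffF3,
      fun p => (p ^ 2 * (1 - p) ^ 2 * (1 - 4 * p) ^ 2 * (1 - 4 * p ^ 2) ^ 2)
        / ((1 - 2 * p + 4 * p ^ 2) ^ 6)⟩,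
    ⟨fun p => 1 / ((1 - 2 * p - 2 * p ^ 2) ^ 2),
      coeffF3,
      fun p => (p ^ 4 * (1 - p) ^ 4 * (1 - 4 * p) * (1 - 4 * p ^ 2))
        / ((1 - 2 * p - 2 * p ^ 2) ^ 6)⟩,
    ⟨fun p => 1 / ((1 - 8 * p + 4 * p ^ 2) ^ 2),
      coeffF3,
      fun p => -(p * (1 - p) * (1 - 4 * p) * (1 - 4 * p ^ 2) ^ 4)
        / ((1 - 8 * p + 4 * p ^ 2) ^ 6)⟩]

/-- Level 4, with `F₄`. -/
def level4 : List Expression :=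
  [⟨fun p => 1 / ((1 - 2 * p) * (1 + 2 * p) ^ 3),
      coeffF4,
      fun p => (p * (1 - p) ^ 3 * (1 - 4 * p) ^ 3)
        / ((1 - 2 * p) ^ 2 * (1 + 2 * p) ^ 6)⟩,
    ⟨fun p => 1 / ((1 - 2 * p) ^ 3 * (1 + 2 * p)),
      coeffF4,
      fun p => (p ^ 3 * (1 - p) * (1 - 4 * p))
        / ((1 - 2 * p) ^ 6 * (1 + 2 * p) ^ 2)⟩,
    ⟨fun p => 1 / ((1 - 4 * p) ^ 3),
      coeffF4,
      fun p => -(p * (1 - 2 * p) * (1 + 2 * p) ^ 3 * (1 - p) ^ 3)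
        / ((1 - 4 * p) ^ 6)⟩,
    ⟨fun p => 1 / (1 - 4 * p),
      coeffF4,
      fun p => -(p ^ 3 * (1 - 2 * p) ^ 3 * (1 + 2 * p) * (1 - p))
        / ((1 - 4 * p) ^ 2)⟩,
    ⟨fun p => 1 / ((1 - 2 * p) ^ (1 / 2 : ℂ) * (1 + 2 * p) ^ (3 / 2 : ℂ) * (1 - 4 * p) ^ (3 / 2 : ℂ)),
      coeffF4,
      fun p => -(p ^ 2 * (1 - p) ^ 6)
        / ((1 - 2 * p) * (1 + 2 * p) ^ 3 * (1 - 4 * p) ^ 3)⟩,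
    ⟨fun p => 1 / ((1 - 2 * p) ^ (3 / 2 : ℂ) * (1 + 2 * p) ^ (1 / 2 : ℂ) * (1 - 4 * p) ^ (1 / 2 : ℂ)),
      coeffF4,
      fun p => -(p ^ 6 * (1 - p) ^ 2)
        / ((1 - 2 * p) ^ 3 * (1 + 2 * p) * (1 - 4 * p))⟩]

/-- Level 6, the functions `F6a`, `F6b`, `F6c`. -/
def level6F : List Expression :=
  [⟨fun p => 1 / (1 - 16 * p + 24 * p ^ 2 + 32 * p ^ 3 - 32 * p ^ 4),
      coeffF6a,
      fun p => (p * (1 - p) * (1 - 4 * p) ^ 2 * (1 - 2 * p) * (1 + 2 * p))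
        / ((1 - 16 * p + 24 * p ^ 2 + 32 * p ^ 3 - 32 * p ^ 4) ^ 2)⟩,
    ⟨fun p => 1 / (1 - 4 * p - 12 * p ^ 2 + 32 * p ^ 3 - 8 * p ^ 4),
      coeffF6a,
      fun p => (p ^ 2 * (1 - p) ^ 2 * (1 - 4 * p) * (1 - 2 * p) * (1 + 2 * p))
        / ((1 - 4 * p - 12 * p ^ 2 + 32 * p ^ 3 - 8 * p ^ 4) ^ 2)⟩,
    ⟨fun p => 1 / (1 + 8 * p - 48 * p ^ 2 + 32 * p ^ 3 + 16 * p ^ 4),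
      coeffF6a,
      fun p => (-p * (1 - p) * (1 - 4 * p) * (1 - 2 * p) ^ 2 * (1 + 2 * p) ^ 2)
        / ((1 + 8 * p - 48 * p ^ 2 + 32 * p ^ 3 + 16 * p ^ 4) ^ 2)⟩,
    ⟨fun p => 1 / ((1 - 2 * p + 4 * p ^ 2) * (1 + 4 * p - 8 * p ^ 2)),
      coeffF6b,
      fun p => (p * (1 - p) * (1 - 4 * p) ^ 2 * (1 - 2 * p) * (1 + 2 * p))
        / ((1 - 2 * p + 4 * p ^ 2) ^ 2 * (1 + 4 * p - 8 * p ^ 2) ^ 2)⟩,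
    ⟨fun p => 1 / ((1 - 2 * p - 2 * p ^ 2) * (1 - 2 * p + 4 * p ^ 2)),
      coeffF6b,
      fun p => (p ^ 2 * (1 - p) ^ 2 * (1 - 4 * p) * (1 - 2 * p) * (1 + 2 * p))
        / ((1 - 2 * p - 2 * p ^ 2) ^ 2 * (1 - 2 * p + 4 * p ^ 2) ^ 2)⟩,
    ⟨fun p => 1 / ((1 - 2 * p + 4 * p ^ 2) * (1 - 8 * p + 4 * p ^ 2)),
      coeffF6b,
      fun p => (-p * (1 - p) * (1 - 4 * p) * (1 - 2 * p) ^ 2 * (1 + 2 * p) ^ 2)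
        / ((1 - 2 * p + 4 * p ^ 2) ^ 2 * (1 - 8 * p + 4 * p ^ 2) ^ 2)⟩,
    ⟨fun p => 1 / (1 + 8 * p ^ 2 - 32 * p ^ 3 + 32 * p ^ 4),
      coeffF6c,
      fun p => (p * (1 - p) * (1 - 4 * p) ^ 2 * (1 - 2 * p) * (1 + 2 * p))
        / ((1 + 8 * p ^ 2 - 32 * p ^ 3 + 32 * p ^ 4) ^ 2)⟩,
    ⟨fun p => 1 / (1 - 4 * p + 4 * p ^ 2 + 8 * p ^ 4),
      coeffF6c,
      fun p => (p ^ 2 * (1 - p) ^ 2 * (1 - 4 * p) * (1 - 2 * p) * (1 + 2 * p))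
        / ((1 - 4 * p + 4 * p ^ 2 + 8 * p ^ 4) ^ 2)⟩,
    ⟨fun p => 1 / (1 - 8 * p + 32 * p ^ 2 - 32 * p ^ 3 + 16 * p ^ 4),
      coeffF6c,
      fun p => (-p * (1 - p) * (1 - 4 * p) * (1 - 2 * p) ^ 2 * (1 + 2 * p) ^ 2)
        / ((1 - 8 * p + 32 * p ^ 2 - 32 * p ^ 3 + 16 * p ^ 4) ^ 2)⟩]

/-- Level 6, the functions `G6a`, `G6b`, `G6c`. -/
def level6G : List Expression :=
  [⟨fun p => 1 / ((1 + 2 * p) * (1 - p)),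
      coeffG6a,
      fun p => (p * (1 - 4 * p) ^ 2 * (1 - 2 * p))
        / ((1 + 2 * p) * (1 - p))⟩,
    ⟨fun p => 1 / ((1 - 2 * p) * (1 - p) ^ 2),
      coeffG6a,
      fun p => (p ^ 2 * (1 + 2 * p) * (1 - 4 * p))
        / ((1 - 2 * p) * (1 - p) ^ 2)⟩,
    ⟨fun p => 1 / ((1 - p) * (1 - 4 * p) * (1 - 2 * p) ^ 2),
      coeffG6a,
      fun p => (-p * (1 + 2 * p) ^ 2)
        / ((1 - p) * (1 - 4 * p) * (1 - 2 * p) ^ 2)⟩,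
    ⟨fun p => 1 / ((1 - 4 * p) ^ 2),
      coeffG6b,
      fun p => (p * (1 + 2 * p) * (1 - 2 * p) * (1 - p))
        / ((1 - 4 * p) ^ 2)⟩,
    ⟨fun p => 1 / ((1 - 2 * p) * (1 + 2 * p) * (1 - 4 * p)),
      coeffG6b,
      fun p => (p ^ 2 * (1 - p) ^ 2)
        / ((1 - 2 * p) * (1 + 2 * p) * (1 - 4 * p))⟩,
    ⟨fun p => 1 / ((1 - 2 * p) ^ 2 * (1 + 2 * p) ^ 2),
      coeffG6b,
      fun p => (-p * (1 - p) * (1 - 4 * p))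
        / ((1 - 2 * p) ^ 2 * (1 + 2 * p) ^ 2)⟩,
    ⟨fun p => 1 / ((1 - p) * (1 + 2 * p) * (1 - 4 * p) ^ 2),
      coeffG6c,
      fun p => (p * (1 - 2 * p))
        / ((1 - p) * (1 + 2 * p) * (1 - 4 * p) ^ 2)⟩,
    ⟨fun p => 1 / ((1 + 2 * p) * (1 - p) ^ 2 * (1 - 4 * p)),
      coeffG6c,
      fun p => (p ^ 2 * (1 - 2 * p))
        / ((1 + 2 * p) * (1 - p) ^ 2 * (1 - 4 * p))⟩,
    ⟨fun p => 1 / ((1 - p) * (1 - 4 * p) * (1 + 2 * p) ^ 2),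
      coeffG6c,
      fun p => (-p * (1 - 2 * p) ^ 2)
        / ((1 - p) * (1 - 4 * p) * (1 + 2 * p) ^ 2)⟩]

/-- The forty-two expressions. -/
def fortyTwo : List Expression := level1 ++ level2 ++ level3 ++ level4 ++ level6F ++ level6G

theorem length_fortyTwo : fortyTwo.length = 42 := rfl

end

end FortyTwo

namespace FortyTwo

open scoped Nat Topology
open Filter

noncomputable section

/-! All ten coefficient sequences obey one three-term recurrence, `IsRec`, so each generating
function z satisfies a third-order linear equation in the Euler derivative θ. Put w = 1 - 2ax - ex²
and v = 2bx + (e+f)x². Multiplied by 2z, the third-order equation becomes a total θ-derivative. Its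
constant of integration vanishes at 0, which leaves 2z(wθ²z + ½(θw)θz) - w(θz)² = v z². This is
`IsRec.solves`. Equivalently, √z is a solution of (√w θ)² f = (v/4) f: the third-order operator is a
symmetric square.

The nonlinear equation keeps its shape under y = r(p) z(x(p)), with new W and V computed from r and
x (`Solves.comp`). All forty-two substitutions lead to the same pair W = Q², V, with Q =
(1-p)(1-4p)(1-2p)(1+2p). The germ y with y(0) = 1 is unique (`Solves.eventually_eq`): L = θy/y
solves a Riccati equation, the difference of two Riccati solutions solves a homogeneous linear
first-order equation, and that equation is degenerate at 0 in a way that leaves only the zero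
solution (`HasTheta.eventually_eq_zero`). Hence all forty-two expressions agree near 0.

For a single expression, `Expression.good_of` reduces membership in the common equation to three
identities between rational functions. With U = 1/r², a polynomial of degree at most 8, they are
Qθx/x = kM, w(x)U = M² and k²U³v(x) = `pot`. After denominators are cleared these are polynomial
identities in p. Only r² enters them, so fractional powers cause no branch problem; r(0) = 1 fixes
the sign. Convergence follows from geometric growth of the coefficients together with x(0) = 0. -/

/-! ### The Euler derivative `p * f' p` of germs of analytic functions at `0` -/

/-- `f` is analytic at `0` and `p * f' p = f₁ p` near `0`. -/
structure HasTheta (f f₁ : ℂ → ℂ) : Prop where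
  analytic : AnalyticAt ℂ f 0
  eq : ∀ᶠ p in 𝓝 (0 : ℂ), p * deriv f p = f₁ p

theorem HasTheta.of_analyticAt {f : ℂ → ℂ} (hf : AnalyticAt ℂ f 0) :
    HasTheta f (fun p => p * deriv f p) := ⟨hf, .of_forall fun _ => rfl⟩

namespace HasTheta

variable {f f₁ g g₁ : ℂ → ℂ}

theorem analytic_theta (h : HasTheta f f₁) : AnalyticAt ℂ f₁ 0 :=
  (analyticAt_id.mul h.analytic.deriv).congr h.eq

theorem theta_zero (h : HasTheta f f₁) : f₁ 0 = 0 := by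
  simpa using h.eq.self_of_nhds.symm

theorem congr (h : HasTheta f f₁) (hg : g =ᶠ[𝓝 0] f) (hg₁ : g₁ =ᶠ[𝓝 0] f₁) : HasTheta g g₁ := by
  refine ⟨h.analytic.congr hg.symm, ?_⟩
  filter_upwards [hg.deriv, hg₁, h.eq] with p h1 h2 h3
  rw [h1, h2, h3]

theorem mul (hf : HasTheta f f₁) (hg : HasTheta g g₁) :
    HasTheta (fun p => f p * g p) (fun p => f₁ p * g p + f p * g₁ p) := by
  refine ⟨hf.analytic.mul hg.analytic, ?_⟩
  filter_upwards [hf.eq, hg.eq, hf.analytic.eventually_analyticAt,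
    hg.analytic.eventually_analyticAt] with p h1 h2 h3 h4
  rw [deriv_fun_mul h3.differentiableAt h4.differentiableAt, ← h1, ← h2]
  ring

theorem add (hf : HasTheta f f₁) (hg : HasTheta g g₁) :
    HasTheta (fun p => f p + g p) (fun p => f₁ p + g₁ p) := by
  refine ⟨hf.analytic.add hg.analytic, ?_⟩
  filter_upwards [hf.eq, hg.eq, hf.analytic.eventually_analyticAt,
    hg.analytic.eventually_analyticAt] with p h1 h2 h3 h4
  rw [deriv_fun_add h3.differentiableAt h4.differentiableAt, ← h1, ← h2]
  ring

theorem const (c : ℂ) : HasTheta (fun _ => c) (fun _ => 0) :=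
  ⟨analyticAt_const, by simp⟩

theorem ident : HasTheta (fun p => p) (fun p => p) :=
  ⟨analyticAt_id, by simp⟩

theorem const_mul (c : ℂ) (hf : HasTheta f f₁) :
    HasTheta (fun p => c * f p) (fun p => c * f₁ p) :=
  ((const c).mul hf).congr .rfl (.of_forall fun p => by simp)

theorem sub (hf : HasTheta f f₁) (hg : HasTheta g g₁) :
    HasTheta (fun p => f p - g p) (fun p => f₁ p - g₁ p) :=
  (hf.add (hg.const_mul (-1))).congr (.of_forall fun p => by simp [sub_eq_add_neg])
    (.of_forall fun p => by simp [sub_eq_add_neg])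

theorem inv (hf : HasTheta f f₁) (h0 : f 0 ≠ 0) :
    HasTheta (fun p => (f p)⁻¹) (fun p => -f₁ p / f p ^ 2) := by
  refine ⟨hf.analytic.inv h0, ?_⟩
  filter_upwards [hf.eq, hf.analytic.eventually_analyticAt,
    hf.analytic.continuousAt.eventually_ne h0] with p h1 h2 h3
  rw [(h2.differentiableAt.hasDerivAt.fun_inv h3).deriv, ← h1]
  ring

/-- The chain rule gives θ(z∘x) = z'(x)·θx. Writing θx as x·g turns this into g·(θz)(x) without
dividing by x, which vanishes at 0. -/
theorem comp {z z₁ x x₁ g : ℂ → ℂ} (hz : HasTheta z z₁) (hx : HasTheta x x₁) (hx0 : x 0 = 0)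
    (hg : ∀ᶠ p in 𝓝 (0 : ℂ), x₁ p = x p * g p) :
    HasTheta (fun p => z (x p)) (fun p => g p * z₁ (x p)) := by
  have hz' : AnalyticAt ℂ z (x 0) := by rw [hx0]; exact hz.analytic
  refine ⟨hz'.comp hx.analytic, ?_⟩
  have ht : Tendsto x (𝓝 0) (𝓝 0) := by simpa [hx0] using hx.analytic.continuousAt.tendsto
  filter_upwards [hx.eq, ht.eventually hz.eq, ht.eventually hz.analytic.eventually_analyticAt,
    hx.analytic.eventually_analyticAt, hg] with p h1 h2 h3 h4 h5
  have := (h3.differentiableAt.hasDerivAt.comp p h4.differentiableAt.hasDerivAt).deriv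
  simp only [Function.comp_def] at this
  rw [this, ← h2]
  linear_combination deriv z (x p) * (h1.trans h5)

/-- A solution of `W * θ f = g * f` with `W 0 ≠ 0`, `g 0 = 0` and `f 0 = 0` vanishes near `0`. -/
theorem eventually_eq_zero {W : ℂ → ℂ} (hf : HasTheta f f₁) (hW : ContinuousAt W 0)
    (hg : ContinuousAt g 0) (hW0 : W 0 ≠ 0) (hg0 : g 0 = 0) (hf0 : f 0 = 0)
    (h : ∀ᶠ p in 𝓝 (0 : ℂ), W p * f₁ p = g p * f p) : ∀ᶠ p in 𝓝 (0 : ℂ), f p = 0 := by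
  by_contra hne
  obtain ⟨n, G, hG, hG0, hfG⟩ := hf.analytic.exists_eventuallyEq_pow_smul_nonzero_iff.2 hne
  simp only [sub_zero, smul_eq_mul] at hfG
  have hn : n ≠ 0 := by
    rintro rfl
    exact hG0 (by simpa [hf0] using hfG.self_of_nhds.symm)
  -- With f = pⁿG and G(0) ≠ 0, dividing the equation by pⁿ leaves an identity continuous at 0. Its
  -- value there is n·W(0)·G(0) = 0, which is impossible because f(0) = 0 forces n ≠ 0.
  have key : ∀ᶠ p in 𝓝[≠] (0 : ℂ),
      W p * (n * G p + p * deriv G p) - g p * G p = 0 := by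
    have hfG' := Filter.EventuallyEq.deriv hfG
    have h' := h.and (hf.eq.and (hfG.and (hfG'.and hG.eventually_analyticAt)))
    filter_upwards [nhdsWithin_le_nhds h', self_mem_nhdsWithin] with p ⟨h1, h2, h3, h4, h5⟩ hp
    have hd : deriv (fun z : ℂ => z ^ n * G z) p
        = n * p ^ (n - 1) * G p + p ^ n * deriv G p := by
      rw [deriv_fun_mul (by fun_prop) h5.differentiableAt]
      simp
    have hp0 : p ≠ 0 := hp
    have hpn : p * p ^ (n - 1) = p ^ n := mul_pow_sub_one hn p
    rw [← h2, h3, h4, hd] at h1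
    have : p ^ n * (W p * (n * G p + p * deriv G p) - g p * G p) = 0 := by
      linear_combination h1 - W p * n * G p * hpn
    exact (mul_eq_zero.1 this).resolve_left (pow_ne_zero _ hp0)
  have hc : ContinuousAt (fun p => W p * (n * G p + p * deriv G p) - g p * G p) 0 := by
    have h1 := hG.continuousAt
    have h2 := hG.deriv.continuousAt
    fun_prop
  have h0 := tendsto_nhds_unique (hc.tendsto.mono_left nhdsWithin_le_nhds)
    ((tendsto_const_nhds (x := (0 : ℂ))).congr' (key.mono fun p hp => hp.symm))
  simp [hg0, hW0, hn, hG0] at h0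

end HasTheta

/-! ### A nonlinear second-order equation and its uniqueness -/

/-- `y` is analytic at `0`, `y 0 = 1`, and
`2 y (W θ²y + (θW / 2) θy) - W (θy)² = V y²` near `0`, where `θ = p d/dp` and `W₁ = θW`. -/
def Solves (W W₁ V y : ℂ → ℂ) : Prop :=
  y 0 = 1 ∧ ∃ y₁ y₂ : ℂ → ℂ, HasTheta y y₁ ∧ HasTheta y₁ y₂ ∧ ∀ᶠ p in 𝓝 (0 : ℂ),
    2 * y p * (W p * y₂ p + W₁ p / 2 * y₁ p) - W p * y₁ p ^ 2 = V p * y p ^ 2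

/-- Dividing by y² turns the equation into the Riccati equation 2WθL + (θW)L + WL² = V for L = θy/y,
and L(0) = 0 holds automatically. Two such solutions L, M satisfy 2Wθ(L-M) = -(θW + W(L+M))(L-M), so
L = M. Then θ(y-u) = L(y-u) with y(0) = u(0) gives y = u. -/
theorem Solves.eventually_eq {W W₁ V y u : ℂ → ℂ} (hy : Solves W W₁ V y) (hu : Solves W W₁ V u)
    (hW : HasTheta W W₁) (hW0 : W 0 ≠ 0) : ∀ᶠ p in 𝓝 (0 : ℂ), y p = u p := by
  obtain ⟨hy0, y₁, y₂, hy1, hy2, hye⟩ := hy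
  obtain ⟨hu0, u₁, u₂, hu1, hu2, hue⟩ := hu
  have hy0' : y 0 ≠ 0 := by simp [hy0]
  have hu0' : u 0 ≠ 0 := by simp [hu0]
  have hyn := hy1.analytic.continuousAt.eventually_ne hy0'
  have hun := hu1.analytic.continuousAt.eventually_ne hu0'
  have hL := hy2.mul (hy1.inv hy0')
  have hM := hu2.mul (hu1.inv hu0')
  have hL0 : y₁ 0 = 0 := hy1.theta_zero
  have hM0 : u₁ 0 = 0 := hu1.theta_zero
  have h1 := (hL.sub hM).eventually_eq_zero (W := fun p => 2 * W p)
    (g := fun p => -(W₁ p + W p * (y₁ p * (y p)⁻¹ + u₁ p * (u p)⁻¹)))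
    (hW.analytic.continuousAt.const_mul 2)
    ((hW.analytic_theta.continuousAt.add
      (hW.analytic.continuousAt.mul (hL.analytic.continuousAt.add hM.analytic.continuousAt))).neg)
    (by simpa using hW0) (by simp [hW.theta_zero, hL0, hM0]) (by simp [hL0, hM0])
    (by
      filter_upwards [hye, hue, hyn, hun] with p h1 h2 h3 h4
      have e1 : 2 * (W p * (y₂ p * (y p)⁻¹) + W₁ p / 2 * (y₁ p * (y p)⁻¹))
          - W p * (y₁ p * (y p)⁻¹) ^ 2 = V p := by
        field_simp
        linear_combination h1
      have e2 : 2 * (W p * (u₂ p * (u p)⁻¹) + W₁ p / 2 * (u₁ p * (u p)⁻¹))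
          - W p * (u₁ p * (u p)⁻¹) ^ 2 = V p := by
        field_simp
        linear_combination h2
      linear_combination e1 - e2)
  have h2 := (hy1.sub hu1).eventually_eq_zero (W := fun _ => 1)
    (g := fun p => y₁ p * (y p)⁻¹) continuousAt_const hL.analytic.continuousAt
    one_ne_zero (by simp [hL0]) (by simp [hy0, hu0])
    (by
      filter_upwards [h1, hyn, hun] with p h1 h3 h4
      have : u₁ p * (u p)⁻¹ = y₁ p * (y p)⁻¹ := (sub_eq_zero.1 h1).symm
      have hu' : u₁ p = y₁ p * (y p)⁻¹ * u p := by rw [← this]; field_simp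
      rw [hu']
      field_simp)
  exact h2.mono fun p hp => sub_eq_zero.1 hp

/-- Change of variable and of unknown: `y = r * z(x)`. -/
theorem Solves.comp {w w₁ v z W W₁ V x g r ρ : ℂ → ℂ} {κ : ℂ} (hz : Solves w w₁ v z)
    (hw : HasTheta w w₁) (hW : HasTheta W W₁) (hx : HasTheta x (fun p => x p * g p))
    (hx0 : x 0 = 0) (hg : AnalyticAt ℂ g 0) (hg0 : g 0 ≠ 0)
    (hr : HasTheta r (fun p => r p * ρ p)) (hr0 : r 0 = 1) (hρ : AnalyticAt ℂ ρ 0)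
    (h1 : ∀ᶠ p in 𝓝 (0 : ℂ), W p * g p ^ 2 * r p ^ 2 = κ * w (x p))
    (h2 : ∀ᶠ p in 𝓝 (0 : ℂ), r p ^ 2 * (2 * W p * (p * deriv ρ p) + W₁ p * ρ p + W p * ρ p ^ 2)
      + κ * v (x p) = r p ^ 2 * V p) :
    Solves W W₁ V (fun p => r p * z (x p)) := by
  obtain ⟨hz0, z₁, z₂, hz1, hz2, hze⟩ := hz
  have c0 := hz1.comp hx hx0 (.of_forall fun _ => rfl)
  have c1 := hz2.comp hx hx0 (.of_forall fun _ => rfl)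
  have hρ' := HasTheta.of_analyticAt hρ
  have hg' := HasTheta.of_analyticAt hg
  have hy1 := hr.mul c0
  have hy2 := ((hr.mul hρ').mul c0).add (hr.mul (hg'.mul c1))
  have hd := (hw.comp hx hx0 (.of_forall fun _ => rfl)).const_mul κ
  have hl := (hW.mul (hg'.mul hg')).mul (hr.mul hr)
  have h1' := hl.congr (g := fun p => κ * w (x p)) (h1.mono fun p hp => by
    change κ * w (x p) = _; rw [← hp]; ring) .rfl
  have ht : Tendsto x (𝓝 0) (𝓝 0) := by simpa [hx0] using hx.analytic.continuousAt.tendsto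
  refine ⟨by simp [hr0, hx0, hz0], _, _, hy1, hy2.congr (.of_forall fun p => ?_) .rfl, ?_⟩
  · ring
  filter_upwards [h1, h2, ht.eventually hze, hd.eq, h1'.eq,
    hg.continuousAt.eventually_ne hg0] with p e1 e2 e3 e4 e5 e6
  -- This is the Euler derivative of `h1` with the common factor g cancelled. It matches the
  -- coefficients of z·θz on the two sides, while `h1` and `h2` match the remaining terms.
  have e7 : r p ^ 2 * (2 * W p * (p * deriv g p) + W₁ p * g p + 2 * W p * g p * ρ p)
      = κ * w₁ (x p) := by
    apply mul_left_cancel₀ e6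
    linear_combination e4 - e5
  linear_combination (2 * z (x p) * z₂ (x p) - z₁ (x p) ^ 2) * e1 + z (x p) ^ 2 * e2 + κ * e3
    + z (x p) * z₁ (x p) * e7

/-! ### Power series with geometrically bounded coefficients -/

/-- The coefficients grow at most geometrically. -/
def GeomBounded (c : ℕ → ℂ) : Prop := ∃ K : ℝ, 0 < K ∧ ∀ n, ‖c n‖ ≤ K ^ n

namespace GeomBounded

variable {c : ℕ → ℂ}

/-- Since n ≤ 2ⁿ, the class is closed under θ, so it can be applied repeatedly to a series. -/
theorem natCast_mul (h : GeomBounded c) : GeomBounded (fun n => n * c n) := by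
  obtain ⟨K, hK, h⟩ := h
  refine ⟨2 * K, by positivity, fun n => ?_⟩
  rw [norm_mul, mul_pow, Complex.norm_natCast]
  gcongr
  · exact_mod_cast n.lt_two_pow_self.le
  · exact h n

theorem eventually_summable (h : GeomBounded c) :
    ∀ᶠ x in 𝓝 (0 : ℂ), Summable fun n => c n * x ^ n := by
  obtain ⟨K, hK, h⟩ := h
  filter_upwards [Metric.ball_mem_nhds (0 : ℂ) (inv_pos.2 hK)] with x hx
  rw [mem_ball_zero_iff] at hx
  refine Summable.of_norm_bounded (summable_geometric_of_lt_one
    (r := K * ‖x‖) (by positivity) ?_) fun n => ?_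
  · rwa [← lt_inv_mul_iff₀ hK, mul_one]
  · rw [norm_mul, norm_pow, mul_pow]
    gcongr
    exact h n

theorem hasTheta (h : GeomBounded c) : HasTheta (genFun c) (genFun fun n => n * c n) := by
  obtain ⟨K, hK, h⟩ := h
  -- At half the guaranteed radius 1/K the differentiated terms are bounded by 2K·n·2⁻ⁿ, which is
  -- summable and permits termwise differentiation.
  set s : Set ℂ := Metric.ball 0 (2 * K)⁻¹ with hs
  have hd : ∀ x ∈ s, HasDerivAt (genFun c) (∑' n : ℕ, c n * (n * x ^ (n - 1))) x := by
    intro x hx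
    refine hasDerivAt_tsum_of_isPreconnected (𝕜 := ℂ) (F := ℂ)
      (g := fun n z => c n * z ^ n) (g' := fun n z => c n * (n * z ^ (n - 1)))
      (u := fun n : ℕ => 2 * K * (n * (1 / 2 : ℝ) ^ n))
      (t := s) (y₀ := 0) ?_ Metric.isOpen_ball (convex_ball (0 : ℂ) _).isPreconnected
      (fun n y _ => ?_) (fun n y hy => ?_) ?_ ?_ hx
    · have := summable_pow_mul_geometric_of_norm_lt_one (R := ℝ) 1 (r := 1 / 2) (by norm_num)
      simpa using this.mul_left (2 * K)
    · exact (hasDerivAt_pow n y).const_mul _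
    · rcases n with _ | n
      · simp
      · rw [hs, mem_ball_zero_iff] at hy
        have h3 : K ^ (n + 1) * ((2 * K)⁻¹) ^ n = 2 * K * (1 / 2) ^ (n + 1) := by
          rw [mul_inv, mul_pow, pow_succ K, pow_succ, inv_pow, inv_pow, one_div, inv_pow]
          field_simp
        calc ‖c (n + 1) * (((n + 1 : ℕ) : ℂ) * y ^ (n + 1 - 1))‖
            = ‖c (n + 1)‖ * ((n + 1 : ℕ) * ‖y‖ ^ n) := by
              rw [norm_mul, norm_mul, norm_pow, Complex.norm_natCast]; simp
          _ ≤ K ^ (n + 1) * ((n + 1 : ℕ) * ((2 * K)⁻¹) ^ n) := by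
              gcongr
              exact h _
          _ = (n + 1 : ℕ) * (K ^ (n + 1) * ((2 * K)⁻¹) ^ n) := by ring
          _ = _ := by rw [h3]; ring
    · exact Metric.mem_ball_self (by positivity)
    · exact summable_of_ne_finset_zero (s := {0}) fun n hn => by
        simp [show n ≠ 0 by simpa using hn]
  have hs0 : s ∈ 𝓝 (0 : ℂ) := Metric.ball_mem_nhds _ (by positivity)
  refine ⟨(DifferentiableOn.analyticAt (s := s)
    (fun x hx => (hd x hx).differentiableAt.differentiableWithinAt) hs0), ?_⟩
  filter_upwards [hs0] with x hx
  rw [(hd x hx).deriv, ← tsum_mul_left]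
  refine tsum_congr fun n => ?_
  rcases n with _ | n
  · simp
  · simp only [Nat.add_sub_cancel]
    ring

end GeomBounded

theorem genFun_zero (c : ℕ → ℂ) : genFun c 0 = c 0 := by
  rw [genFun, tsum_eq_single 0 fun n hn => by simp [hn]]
  simp

theorem hasSum_of_succ {u v : ℕ → ℂ} {s : ℂ} (h : HasSum v s) (h0 : u 0 = 0)
    (huv : ∀ n, u (n + 1) = v n) : HasSum u s := by
  rw [← funext huv] at h
  have := (hasSum_nat_add_iff 1).1 h
  rwa [Finset.sum_range_one, h0, add_zero] at this

/-! ### The three-term recurrence common to all the coefficient sequences -/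

/-- `c 0 = 1` and
`(n + 1)³ c (n + 1) = (2n + 1) (a n² + a n + b) c n + n (e n² + f) c (n - 1)`. -/
structure IsRec (a b e f : ℂ) (c : ℕ → ℂ) : Prop where
  zero : c 0 = 1
  succ : ∀ n : ℕ, ((n : ℂ) + 1) ^ 3 * c (n + 1)
    = (2 * n + 1) * (a * n ^ 2 + a * n + b) * c n + n * (e * n ^ 2 + f) * c (n - 1)

namespace IsRec

variable {a b e f : ℂ} {c : ℕ → ℂ}

/-- Both coefficients on the right of the recurrence are O((n+1)³), so division by (n+1)³ bounds
c(n+1) by a constant K - 1 times Kⁿ. -/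
theorem geomBounded (h : IsRec a b e f c) : GeomBounded c := by
  set K : ℝ := 1 + 2 * (2 * ‖a‖ + ‖b‖) + (‖e‖ + ‖f‖) with hK
  have hK1 : 1 ≤ K := by
    have : 0 ≤ 2 * (2 * ‖a‖ + ‖b‖) + (‖e‖ + ‖f‖) := by positivity
    linarith
  have hK0 : 0 < K := by linarith
  refine ⟨K, hK0, fun n => ?_⟩
  induction n using Nat.strong_induction_on with
  | _ n ih =>
    rcases n with _ | n
    · simp [h.zero]
    · have hx : (0 : ℝ) ≤ n := n.cast_nonneg
      have e1 : ‖(2 * (n : ℂ) + 1) * (a * n ^ 2 + a * n + b)‖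
          ≤ ((n : ℝ) + 1) ^ 3 * (2 * (2 * ‖a‖ + ‖b‖)) := by
        have i1 : ‖(2 * (n : ℂ) + 1)‖ ≤ 2 * ((n : ℝ) + 1) := by
          have : (2 * (n : ℂ) + 1) = ((2 * n + 1 : ℕ) : ℂ) := by push_cast; ring
          rw [this, Complex.norm_natCast]
          push_cast
          linarith
        have i2 : ‖a * (n : ℂ) ^ 2 + a * n + b‖ ≤ ((n : ℝ) + 1) ^ 2 * (2 * ‖a‖ + ‖b‖) := by
          calc _ ≤ ‖a‖ * (n : ℝ) ^ 2 + ‖a‖ * n + ‖b‖ := by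
                refine (norm_add₃_le).trans ?_
                simp
            _ ≤ ‖a‖ * ((n : ℝ) + 1) ^ 2 + ‖a‖ * ((n : ℝ) + 1) ^ 2 + ‖b‖ * ((n : ℝ) + 1) ^ 2 := by
                gcongr
                · linarith
                · nlinarith
                · exact le_mul_of_one_le_right (norm_nonneg _) (by nlinarith)
            _ = _ := by ring
        rw [norm_mul]
        calc _ ≤ 2 * ((n : ℝ) + 1) * (((n : ℝ) + 1) ^ 2 * (2 * ‖a‖ + ‖b‖)) := by gcongr
          _ = _ := by ring
      have e2 : ‖(n : ℂ) * (e * n ^ 2 + f)‖ ≤ ((n : ℝ) + 1) ^ 3 * (‖e‖ + ‖f‖) := by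
        rw [norm_mul, Complex.norm_natCast]
        calc _ ≤ (n : ℝ) * (‖e‖ * (n : ℝ) ^ 2 + ‖f‖) := by
              gcongr
              refine (norm_add_le _ _).trans ?_
              simp
          _ ≤ ((n : ℝ) + 1) * (‖e‖ * ((n : ℝ) + 1) ^ 2 + ‖f‖ * ((n : ℝ) + 1) ^ 2) := by
              gcongr
              · linarith
              · linarith
              · exact le_mul_of_one_le_right (norm_nonneg _) (by nlinarith)
          _ = _ := by ring
      have b1 : ‖c n‖ ≤ K ^ n := ih n (by omega)
      -- The bound K ≥ 1 also covers n = 0, where the truncated index n - 1 is 0.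
      have b2 : ‖c (n - 1)‖ ≤ K ^ n :=
        (ih (n - 1) (by omega)).trans (pow_le_pow_right₀ hK1 (by omega))
      have hpos : (0 : ℝ) < ((n : ℝ) + 1) ^ 3 := by positivity
      refine le_of_mul_le_mul_left ?_ hpos
      have hn : ‖((n : ℂ) + 1) ^ 3‖ = ((n : ℝ) + 1) ^ 3 := by
        have : ((n : ℂ) + 1) = ((n + 1 : ℕ) : ℂ) := by push_cast; ring
        rw [this, norm_pow, Complex.norm_natCast]
        push_cast
        ring
      calc ((n : ℝ) + 1) ^ 3 * ‖c (n + 1)‖ = ‖((n : ℂ) + 1) ^ 3 * c (n + 1)‖ := by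
            rw [norm_mul, hn]
        _ ≤ ((n : ℝ) + 1) ^ 3 * (2 * (2 * ‖a‖ + ‖b‖)) * K ^ n
            + ((n : ℝ) + 1) ^ 3 * (‖e‖ + ‖f‖) * K ^ n := by
            rw [h.succ]
            refine (norm_add_le _ _).trans ?_
            rw [norm_mul, norm_mul _ (c (n - 1))]
            gcongr
        _ = ((n : ℝ) + 1) ^ 3 * ((K - 1) * K ^ n) := by rw [hK]; ring
        _ ≤ ((n : ℝ) + 1) ^ 3 * K ^ (n + 1) := by
            rw [pow_succ' K n]
            gcongr
            linarith

/-- In operator form the recurrence reads θ³y = x(2θ+1)(aθ²+aθ+b)y + x²(θ+1)(e(θ+1)²+f)y; the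
coefficients here are these products expanded. -/
theorem eventually_ode (h : IsRec a b e f c) : ∀ᶠ x in 𝓝 (0 : ℂ),
    genFun (fun n => n * (n * (n * c n))) x
      = x * (2 * a * genFun (fun n => n * (n * (n * c n))) x
          + 3 * a * genFun (fun n => n * (n * c n)) x
          + (a + 2 * b) * genFun (fun n => n * c n) x + b * genFun c x)
        + x ^ 2 * (e * genFun (fun n => n * (n * (n * c n))) x
          + 3 * e * genFun (fun n => n * (n * c n)) x
          + (3 * e + f) * genFun (fun n => n * c n) x + (e + f) * genFun c x) := by
  have g0 := h.geomBounded
  have g1 := g0.natCast_mul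
  have g2 := g1.natCast_mul
  have g3 := g2.natCast_mul
  filter_upwards [g0.eventually_summable, g1.eventually_summable, g2.eventually_summable,
    g3.eventually_summable] with x s0 s1 s2 s3
  have t0 := s0.hasSum
  have t1 := s1.hasSum
  have t2 := s2.hasSum
  have t3 := s3.hasSum
  have u1 := ((((t3.mul_left (2 * a)).add (t2.mul_left (3 * a))).add
    (t1.mul_left (a + 2 * b))).add (t0.mul_left b)).mul_left x
  have u2 := ((((t3.mul_left e).add (t2.mul_left (3 * e))).add
    (t1.mul_left (3 * e + f))).add (t0.mul_left (e + f))).mul_left (x ^ 2)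
  -- A factor x shifts the index by one, so the x² part is shifted here and once more in `v3`. The
  -- initial term added here vanishes because of the factor n.
  have v2 := hasSum_of_succ
    (u := fun n : ℕ => (n : ℂ) * (e * n ^ 2 + f) * c (n - 1) * x ^ (n + 1)) u2 (by simp)
    fun n => by
      simp only [Nat.add_sub_cancel]
      push_cast
      ring
  have v3 := hasSum_of_succ (u := fun n : ℕ => (n : ℂ) * (n * (n * c n)) * x ^ n) (u1.add v2)
    (by simp) fun n => by
      push_cast
      linear_combination x ^ (n + 1) * h.succ n
  exact t3.unique v3

/-- The θ²-coefficient of the third-order equation is exactly ³⁄₂ of θw, and this makes 2y times the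
equation the Euler derivative of the quantity `hE`. That quantity is therefore constant, and it is 0
at x = 0 because θy, θ²y and v all vanish there. -/
theorem solves (h : IsRec a b e f c) :
    Solves (fun x => 1 - 2 * a * x - e * x ^ 2) (fun x => -2 * a * x - 2 * e * x ^ 2)
      (fun x => 2 * b * x + (e + f) * x ^ 2) (genFun c) := by
  have g0 := h.geomBounded
  have h0 := g0.hasTheta
  have h1 := g0.natCast_mul.hasTheta
  have h2 := g0.natCast_mul.natCast_mul.hasTheta
  refine ⟨by rw [genFun_zero, h.zero], _, _, h0, h1, ?_⟩
  have hX := HasTheta.ident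
  have hX2 := hX.mul hX
  have hw := ((HasTheta.const 1).sub (hX.const_mul (2 * a))).sub (hX2.const_mul e)
  have hw1 := (hX.const_mul (-a)).sub (hX2.const_mul e)
  have hv := (hX.const_mul (2 * b)).add (hX2.const_mul (e + f))
  have hE := (((h0.const_mul 2).mul ((hw.mul h2).add (hw1.mul h1))).sub
    (hw.mul (h1.mul h1))).sub (hv.mul (h0.mul h0))
  have key := hE.eventually_eq_zero (W := fun _ => 1) (g := fun _ => 0) continuousAt_const
    continuousAt_const one_ne_zero rfl (by simp [genFun_zero])
    (by
      filter_upwards [h.eventually_ode] with x hx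
      linear_combination 2 * genFun c x * hx)
  filter_upwards [key] with x hx
  linear_combination hx

end IsRec

/-! ### The recurrences of the hypergeometric and Apéry-like coefficients -/

theorem poch_zero (s : ℂ) : poch s 0 = 1 := by simp [poch]

theorem poch_succ (s : ℂ) (n : ℕ) : poch s (n + 1) = poch s n * (s + n) :=
  ascPochhammer_succ_eval n s

theorem poch_one_ne_zero (n : ℕ) : poch 1 n ≠ 0 := by
  induction n with
  | zero => simp [poch_zero]
  | succ n ih =>
    rw [poch_succ]
    refine mul_ne_zero ih ?_
    rw [add_comm]
    exact n.cast_add_one_ne_zero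

/-- The ratio of consecutive coefficients is 4C(n+½)(n+s)(n+1-s)/(n+1)³, and (n+s)(n+1-s) = n² + n +
s(1-s), so only two terms of the recurrence survive. -/
theorem isRec_hypCoeff (s C : ℂ) :
    IsRec (2 * C) (2 * C * (s * (1 - s))) 0 0 (hypCoeff s C) := by
  refine ⟨by simp [hypCoeff, hyp32Coeff, poch_zero], fun n => ?_⟩
  have h1 := poch_one_ne_zero n
  have h2 : (n ! : ℂ) ≠ 0 := by exact_mod_cast n.factorial_ne_zero
  have h3 : (n : ℂ) + 1 ≠ 0 := n.cast_add_one_ne_zero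
  have h4 : 1 + (n : ℂ) ≠ 0 := by rwa [add_comm]
  simp only [hypCoeff, hyp32Coeff, poch_succ, Nat.factorial_succ]
  push_cast
  field_simp
  ring

theorem isRec_aperyG (α β γ : ℂ) :
    IsRec (-α) (-(α - 2 * β)) (-(α ^ 2 + 4 * γ)) 0 (aperyG α β γ) := by
  refine ⟨T_zero α β γ, fun n => ?_⟩
  simp only [aperyG]
  rw [T_rec]
  ring

/-- The relation (n+1)B(n+1) = 2(2n+1)B(n) for central binomials supplies the third factor n+1.
Using it a second time on n·B(n) turns the γ-term into 4γn(2n+1)(2n-1) = n(16γn² - 4γ). -/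
theorem isRec_aperyF (α β γ : ℂ) :
    IsRec (2 * α) (2 * β) (16 * γ) (-4 * γ) (aperyF α β γ) := by
  refine ⟨by simp [aperyF, t_zero], fun n => ?_⟩
  have key : ∀ n : ℕ, ((n : ℂ) + 1) * ((2 * (n + 1)).choose (n + 1) : ℂ)
      = 2 * (2 * n + 1) * ((2 * n).choose n : ℂ) := fun n => by
    exact_mod_cast Nat.succ_mul_centralBinom_succ n
  have ht := t_rec α β γ n
  have k0 := key n
  simp only [aperyF]
  rcases n with _ | n
  · simp only [Nat.cast_zero] at *
    linear_combination (t α β γ 1) * k0 + 2 * ((2 * 0).choose 0 : ℂ) * ht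
  · have k1 := key n
    simp only [Nat.add_sub_cancel] at *
    push_cast at *
    set A : ℂ := ((2 * (n + 1 + 1)).choose (n + 1 + 1) : ℂ)
    set B : ℂ := ((2 * (n + 1)).choose (n + 1) : ℂ)
    set D : ℂ := ((2 * n).choose n : ℂ)
    linear_combination ((n : ℂ) + 1 + 1) ^ 2 * t α β γ (n + 1 + 1) * k0
      + 2 * (2 * ((n : ℂ) + 1) + 1) * B * ht
      + 2 * (2 * ((n : ℂ) + 1) + 1) * γ * ((n : ℂ) + 1) * t α β γ n * k1

/-! ### Logarithmic derivatives -/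

/-- `p * f' p = f p * (n p / d p)` near `0`, where `f`, `n`, `d` are analytic at `0` and
`d 0 ≠ 0`. -/
structure HasLogTheta (f n d : ℂ → ℂ) : Prop where
  theta : HasTheta f (fun p => f p * (n p / d p))
  num : AnalyticAt ℂ n 0
  den : AnalyticAt ℂ d 0
  den_ne : d 0 ≠ 0

namespace HasLogTheta

variable {f f' n n' d d' : ℂ → ℂ}

theorem eventually_den_ne (h : HasLogTheta f n d) : ∀ᶠ p in 𝓝 (0 : ℂ), d p ≠ 0 :=
  h.den.continuousAt.eventually_ne h.den_ne

theorem mul (h : HasLogTheta f n d) (h' : HasLogTheta f' n' d') :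
    HasLogTheta (fun p => f p * f' p) (fun p => n p * d' p + n' p * d p)
      (fun p => d p * d' p) := by
  refine ⟨(h.theta.mul h'.theta).congr .rfl ?_, (h.num.mul h'.den).add (h'.num.mul h.den),
    h.den.mul h'.den, mul_ne_zero h.den_ne h'.den_ne⟩
  filter_upwards [h.eventually_den_ne, h'.eventually_den_ne] with p h1 h2
  field_simp

theorem neg (h : HasLogTheta f n d) : HasLogTheta (fun p => -f p) n d :=
  ⟨(h.theta.const_mul (-1)).congr (.of_forall fun p => by simp) (.of_forall fun p => by simp),
    h.num, h.den, h.den_ne⟩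

theorem pow (h : HasLogTheta f n d) (m : ℕ) :
    HasLogTheta (fun p => f p ^ m) (fun p => m * n p) d := by
  refine ⟨?_, analyticAt_const.mul h.num, h.den, h.den_ne⟩
  induction m with
  | zero =>
    exact (HasTheta.const 1).congr (.of_forall fun p => by simp) (.of_forall fun p => by simp)
  | succ m ih =>
    refine (ih.mul h.theta).congr (.of_forall fun p => pow_succ _ _) (.of_forall fun p => ?_)
    push_cast
    ring

theorem div (h : HasLogTheta f n d) (h' : HasLogTheta f' n' d') (h0 : f' 0 ≠ 0) :
    HasLogTheta (fun p => f p / f' p) (fun p => n p * d' p - n' p * d p)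
      (fun p => d p * d' p) := by
  refine ⟨(h.theta.mul (h'.theta.inv h0)).congr (.of_forall fun p => div_eq_mul_inv _ _) ?_,
    (h.num.mul h'.den).sub (h'.num.mul h.den), h.den.mul h'.den, mul_ne_zero h.den_ne h'.den_ne⟩
  filter_upwards [h'.theta.analytic.continuousAt.eventually_ne h0, h.eventually_den_ne,
    h'.eventually_den_ne] with p h1 h2 h3
  field_simp
  ring

/-- The quotient θp/p = 1 is regular although p vanishes at 0. This is how arguments x(p) with a
zero at the origin are covered. -/
theorem ident : HasLogTheta (fun p => p) (fun _ => 1) (fun _ => 1) :=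
  ⟨HasTheta.ident.congr .rfl (.of_forall fun p => by simp), analyticAt_const, analyticAt_const,
    one_ne_zero⟩

end HasLogTheta

theorem HasTheta.hasLogTheta {f f₁ : ℂ → ℂ} (h : HasTheta f f₁) (h0 : f 0 ≠ 0) :
    HasLogTheta f f₁ f := by
  refine ⟨h.congr .rfl ?_, h.analytic_theta, h.analytic, h0⟩
  filter_upwards [h.analytic.continuousAt.eventually_ne h0] with p hp
  field_simp

/-- The polynomial `1 + a₁ p + ⋯ + a₈ p⁸`. -/
def poly8 (a₁ a₂ a₃ a₄ a₅ a₆ a₇ a₈ p : ℂ) : ℂ :=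
  1 + a₁ * p + a₂ * p ^ 2 + a₃ * p ^ 3 + a₄ * p ^ 4 + a₅ * p ^ 5 + a₆ * p ^ 6 + a₇ * p ^ 7
    + a₈ * p ^ 8

/-- The polynomial `a₁ p + ⋯ + a₈ p⁸`. -/
def tail8 (a₁ a₂ a₃ a₄ a₅ a₆ a₇ a₈ p : ℂ) : ℂ :=
  a₁ * p + a₂ * p ^ 2 + a₃ * p ^ 3 + a₄ * p ^ 4 + a₅ * p ^ 5 + a₆ * p ^ 6 + a₇ * p ^ 7
    + a₈ * p ^ 8

/-- θ multiplies the coefficient of pʲ by j. Degree 8 suffices for every U = 1/r² that occurs. -/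
theorem hasTheta_tail8 (a₁ a₂ a₃ a₄ a₅ a₆ a₇ a₈ : ℂ) :
    HasTheta (tail8 a₁ a₂ a₃ a₄ a₅ a₆ a₇ a₈)
      (tail8 a₁ (2 * a₂) (3 * a₃) (4 * a₄) (5 * a₅) (6 * a₆) (7 * a₇) (8 * a₈)) := by
  have h (n : ℕ) (c : ℂ) := (HasLogTheta.ident.pow n).theta.const_mul c
  refine ((((((((h 1 a₁).add (h 2 a₂)).add (h 3 a₃)).add (h 4 a₄)).add (h 5 a₅)).add
    (h 6 a₆)).add (h 7 a₇)).add (h 8 a₈)).congr (.of_forall fun p => ?_) (.of_forall fun p => ?_)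
  · simp [tail8]
  · simp only [tail8]
    push_cast
    ring

theorem hasTheta_poly8 (a₁ a₂ a₃ a₄ a₅ a₆ a₇ a₈ : ℂ) :
    HasTheta (poly8 a₁ a₂ a₃ a₄ a₅ a₆ a₇ a₈)
      (tail8 a₁ (2 * a₂) (3 * a₃) (4 * a₄) (5 * a₅) (6 * a₆) (7 * a₇) (8 * a₈)) :=
  ((HasTheta.const 1).add (hasTheta_tail8 a₁ a₂ a₃ a₄ a₅ a₆ a₇ a₈)).congr
    (.of_forall fun p => by simp only [poly8, tail8]; ring) (.of_forall fun p => by simp)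

/-- Logarithmic derivative of a polynomial of degree at most `6` with constant term `1`. -/
theorem hasLogTheta_poly (a₁ a₂ a₃ a₄ a₅ a₆ : ℂ) {F : ℂ → ℂ}
    (hF : ∀ p, F p = poly8 a₁ a₂ a₃ a₄ a₅ a₆ 0 0 p := by intro p; simp only [poly8]; ring) :
    HasLogTheta F (tail8 a₁ (2 * a₂) (3 * a₃) (4 * a₄) (5 * a₅) (6 * a₆) 0 0) F := by
  have h := hasTheta_poly8 a₁ a₂ a₃ a₄ a₅ a₆ 0 0
  rw [mul_zero, mul_zero, ← funext hF] at h
  exact h.hasLogTheta (by simp [hF, poly8])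

theorem hasLogTheta_one_sub : HasLogTheta (fun p => 1 - p) (fun p => -p) (fun p => 1 - p) := by
  have h := hasLogTheta_poly (-1) 0 0 0 0 0 (F := fun p => 1 - p)
  convert h using 1
  funext p
  simp [tail8]

theorem hasLogTheta_one_sub_mul (c : ℂ) :
    HasLogTheta (fun p => 1 - c * p) (fun p => -(c * p)) (fun p => 1 - c * p) := by
  have h := hasLogTheta_poly (-c) 0 0 0 0 0 (F := fun p => 1 - c * p)
  convert h using 1
  funext p
  simp [tail8]

theorem hasLogTheta_one_add_mul (c : ℂ) :
    HasLogTheta (fun p => 1 + c * p) (fun p => c * p) (fun p => 1 + c * p) := by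
  have h := hasLogTheta_poly c 0 0 0 0 0 (F := fun p => 1 + c * p)
  convert h using 1
  funext p
  simp [tail8]

/-! ### The common differential equation of the forty-two expressions -/

/-- `p Q(p) d/dp` is the derivation in which the common equation is written. -/
def baseQ (p : ℂ) : ℂ := (1 - p) * (1 - 4 * p) * (1 - 2 * p) * (1 + 2 * p)

/-- The Euler derivative of `baseQ`. -/
def baseQTheta (p : ℂ) : ℂ := -5 * p + 60 * p ^ 3 - 64 * p ^ 4

/-- The potential of the common equation. -/
def baseV (p : ℂ) : ℂ :=
  8 * p - 40 * p ^ 2 - 192 * p ^ 3 + 1376 * p ^ 4 - 1408 * p ^ 5 - 3840 * p ^ 6 + 8192 * p ^ 7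
    - 4096 * p ^ 8

theorem hasTheta_baseQ : HasTheta baseQ baseQTheta :=
  (hasTheta_poly8 (-5) 0 20 (-16) 0 0 0 0).congr
    (.of_forall fun p => by simp only [baseQ, poly8]; ring)
    (.of_forall fun p => by simp only [baseQTheta, tail8]; ring)

/-- The expression has a convergent series and solves the common equation near `0`. -/
def Expression.Good (E : Expression) : Prop :=
  Solves (fun p => baseQ p * baseQ p) (fun p => baseQTheta p * baseQ p + baseQ p * baseQTheta p)
    baseV E.value ∧ ∀ᶠ p in 𝓝 (0 : ℂ), E.Converges p

theorem Expression.Good.eventually_eq {E E' : Expression} (h : E.Good) (h' : E'.Good) :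
    ∀ᶠ p in 𝓝 (0 : ℂ), E.value p = E'.value p :=
  h.1.eventually_eq h'.1 (hasTheta_baseQ.mul hasTheta_baseQ) (by simp [baseQ])

/-- The value that the common equation forces on `k² U³ (2 b x + (e + f) x²)` when
`U = 1 / r² = 1 + a₁ p + ⋯ + a₈ p⁸`. -/
def pot (a₁ a₂ a₃ a₄ a₅ a₆ a₇ a₈ p : ℂ) : ℂ :=
  baseV p * poly8 a₁ a₂ a₃ a₄ a₅ a₆ a₇ a₈ p ^ 2
    - baseQ p ^ 2 * tail8 a₁ (2 * a₂) (3 * a₃) (4 * a₄) (5 * a₅) (6 * a₆) (7 * a₇) (8 * a₈) p ^ 2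
        * (5 / 4)
    + baseQ p * poly8 a₁ a₂ a₃ a₄ a₅ a₆ a₇ a₈ p
      * (baseQTheta p * tail8 a₁ (2 * a₂) (3 * a₃) (4 * a₄) (5 * a₅) (6 * a₆) (7 * a₇) (8 * a₈) p
        + baseQ p * tail8 a₁ (4 * a₂) (9 * a₃) (16 * a₄) (25 * a₅) (36 * a₆) (49 * a₇) (64 * a₈) p)

/-- A criterion in terms of rational identities, where `U = 1 / r²` and `θx / x = k M / Q`. -/
theorem Expression.good_of {a b e f : ℂ} {c : ℕ → ℂ} (hc : IsRec a b e f c) {r x n d : ℂ → ℂ}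
    (hx : HasLogTheta x n d) (k : ℂ) (a₁ a₂ a₃ a₄ a₅ a₆ a₇ a₈ : ℂ) (U M : ℂ → ℂ)
    (hk : k ≠ 0) (hx0 : x 0 = 0) (hr : AnalyticAt ℂ r 0) (hr0 : r 0 = 1)
    (hU : ∀ p, U p = poly8 a₁ a₂ a₃ a₄ a₅ a₆ a₇ a₈ p)
    (hrU : ∀ p, U p ≠ 0 → r p ^ 2 * U p = 1)
    (hg : ∀ᶠ p in 𝓝 (0 : ℂ), n p / d p * baseQ p = k * M p)
    (hw : ∀ p, U p ≠ 0 → (1 - 2 * a * x p - e * x p ^ 2) * U p = M p ^ 2)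
    (hV : ∀ p, U p ≠ 0 → k ^ 2 * U p ^ 3 * (2 * b * x p + (e + f) * x p ^ 2)
      = pot a₁ a₂ a₃ a₄ a₅ a₆ a₇ a₈ p) :
    Expression.Good ⟨r, c, x⟩ := by
  have hU1 : HasTheta U _ := (hasTheta_poly8 a₁ a₂ a₃ a₄ a₅ a₆ a₇ a₈).congr (.of_forall hU) .rfl
  have hU2 := hasTheta_tail8 a₁ (2 * a₂) (3 * a₃) (4 * a₄) (5 * a₅) (6 * a₆) (7 * a₇) (8 * a₈)
  have e2 (p : ℂ) : tail8 a₁ (2 * (2 * a₂)) (3 * (3 * a₃)) (4 * (4 * a₄)) (5 * (5 * a₅))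
      (6 * (6 * a₆)) (7 * (7 * a₇)) (8 * (8 * a₈)) p
      = tail8 a₁ (4 * a₂) (9 * a₃) (16 * a₄) (25 * a₅) (36 * a₆) (49 * a₇) (64 * a₈) p := by
    simp only [tail8]
    ring
  set U₁ := tail8 a₁ (2 * a₂) (3 * a₃) (4 * a₄) (5 * a₅) (6 * a₆) (7 * a₇) (8 * a₈)
  have hU0 : U 0 = 1 := by simp [hU, poly8]
  have hUn := hU1.analytic.continuousAt.eventually_ne (hU0 ▸ one_ne_zero : U 0 ≠ 0)
  have hr' := HasTheta.of_analyticAt hr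
  have hρ := (hU2.mul (hU1.inv (hU0 ▸ one_ne_zero : U 0 ≠ 0))).const_mul (-1 / 2)
  -- Differentiating r²U = 1 yields θr/r = -θU/(2U), so no fractional power has to be differentiated
  -- explicitly.
  have hprod := ((hr'.mul hr').mul hU1).congr (g := fun _ => 1)
    (hUn.mono fun p hp => by linear_combination -hrU p hp) .rfl
  have hrl : HasTheta r (fun p => r p * (-1 / 2 * (U₁ p * (U p)⁻¹))) := by
    refine hr'.congr .rfl ?_
    filter_upwards [hprod.eq, hUn] with p h1 h2
    have h3 : r p ≠ 0 := fun h => by simpa [h] using hrU p h2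
    simp only [deriv_const, mul_zero] at h1
    have h4 : r p * (2 * (p * deriv r p) * U p + r p * U₁ p) = 0 := by linear_combination -h1
    have h5 := (mul_eq_zero.1 h4).resolve_left h3
    field_simp
    linear_combination -h5
  refine ⟨?_, ?_⟩
  · refine hc.solves.comp (κ := k ^ 2) ?_ (hasTheta_baseQ.mul hasTheta_baseQ) hx.theta hx0
      (hx.num.div hx.den hx.den_ne) ?_ hrl hr0 hρ.analytic ?_ ?_
    · have hX := HasTheta.ident
      refine (((HasTheta.const 1).sub (hX.const_mul (2 * a))).sub
        ((hX.mul hX).const_mul e)).congr (.of_forall fun p => ?_) (.of_forall fun p => ?_) <;> ring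
    -- If θx/x vanished at 0, then M(0) = 0, whereas w(x)U = M² gives M(0)² = 1.
    · intro h0
      have h1 := hg.self_of_nhds
      have h2 := hw 0 (by simp [hU0])
      rw [h0, zero_mul, eq_comm, mul_eq_zero, or_iff_right hk] at h1
      simp [h1, hx0, hU0] at h2
    · filter_upwards [hUn, hg] with p h0 i1
      have i2 := hw p h0
      have i3 := hrU p h0
      linear_combination (n p / d p * baseQ p + k * M p) * r p ^ 2 * i1 - k ^ 2 * r p ^ 2 * i2
        + k ^ 2 * (1 - 2 * a * x p - e * x p ^ 2) * i3
    · filter_upwards [hUn, hρ.eq] with p h0 h5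
      have i2 := hV p h0
      have i3 := hrU p h0
      have i4 : r p ^ 2 = (U p)⁻¹ := eq_inv_of_mul_eq_one_left i3
      rw [h5, i4, e2]
      have : k ^ 2 * (2 * b * x p + (e + f) * x p ^ 2) = (U p)⁻¹ ^ 3 *
          (k ^ 2 * U p ^ 3 * (2 * b * x p + (e + f) * x p ^ 2)) := by
        field_simp
      rw [this, i2, pot, ← hU]
      change _ + (U p)⁻¹ ^ 3 * (_ - _ * U₁ p ^ 2 * _ + _ * (_ * U₁ p + _)) = _
      field_simp
      ring
  · have ht : Tendsto x (𝓝 0) (𝓝 0) := by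
      simpa [hx0] using hx.theta.analytic.continuousAt.tendsto
    exact ht.eventually hc.geomBounded.eventually_summable

/-! ### The ten coefficient sequences and the squares of the prefactors -/

theorem isRec_coeffF1 : IsRec 864 120 0 0 coeffF1 := by
  convert isRec_hypCoeff (1 / 6) 432 using 1 <;> norm_num [coeffF1]

theorem isRec_coeffF2 : IsRec 128 24 0 0 coeffF2 := by
  convert isRec_hypCoeff (1 / 4) 64 using 1 <;> norm_num [coeffF2]

theorem isRec_coeffF3 : IsRec 54 12 0 0 coeffF3 := by
  convert isRec_hypCoeff (1 / 3) 27 using 1 <;> norm_num [coeffF3]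

theorem isRec_coeffF4 : IsRec 32 8 0 0 coeffF4 := by
  convert isRec_hypCoeff (1 / 2) 16 using 1 <;> norm_num [coeffF4]

theorem isRec_coeffF6a : IsRec (-34) (-12) (-1152) 288 coeffF6a := by
  convert isRec_aperyF (-17) (-6) (-72) using 1 <;> norm_num [coeffF6a]

theorem isRec_coeffF6b : IsRec 20 6 (-144) 36 coeffF6b := by
  convert isRec_aperyF 10 3 (-9) using 1 <;> norm_num [coeffF6b]

theorem isRec_coeffF6c : IsRec 14 4 128 (-32) coeffF6c := by
  convert isRec_aperyF 7 2 8 using 1 <;> norm_num [coeffF6c]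

theorem isRec_coeffG6a : IsRec 17 5 (-1) 0 coeffG6a := by
  convert isRec_aperyG (-17) (-6) (-72) using 1 <;> norm_num [coeffG6a]

theorem isRec_coeffG6b : IsRec (-10) (-4) (-64) 0 coeffG6b := by
  convert isRec_aperyG 10 3 (-9) using 1 <;> norm_num [coeffG6b]

theorem isRec_coeffG6c : IsRec (-7) (-3) (-81) 0 coeffG6c := by
  convert isRec_aperyG 7 2 8 using 1 <;> norm_num [coeffG6c]

theorem one_div_sq_mul {u D : ℂ} (h : u ^ 2 = D) (hD : D ≠ 0) : (1 / u) ^ 2 * D = 1 := by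
  rw [div_pow, one_pow, h, one_div_mul_cancel hD]

/-- Squaring undoes the principal square root for every z, so r² is rational with no branch
condition. -/
theorem cpow_half_sq (z : ℂ) : (z ^ (1 / 2 : ℂ)) ^ 2 = z := by
  rw [← Complex.cpow_mul_nat]
  norm_num

theorem cpow_three_half_sq (z : ℂ) : (z ^ (3 / 2 : ℂ)) ^ 2 = z ^ 3 := by
  rw [← Complex.cpow_mul_nat, ← Complex.cpow_natCast]
  norm_num


/-! ### Polynomial criteria, one for each shape of prefactor and argument -/

/-- The criterion for `₃F₂(1/2, 1/6, 5/6; 1, 1; 1728 x)`, with `r = 1 / (A B)^{1/2}` and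
`x = N / (A B)³`. -/
theorem Expression.good_of_sqrt_prefactor {c : ℕ → ℂ} (hc : IsRec 864 120 0 0 c)
    {A B N nA dA nB dB nN dN : ℂ → ℂ} (hA : HasLogTheta A nA dA) (hB : HasLogTheta B nB dB)
    (hN : HasLogTheta N nN dN) (k : ℂ) (a₁ a₂ a₃ a₄ a₅ a₆ a₇ a₈ : ℂ) (S : ℂ → ℂ)
    (h0 : k ≠ 0 ∧ A 0 = 1 ∧ B 0 = 1 ∧ N 0 = 0 := by norm_num)
    (hU : ∀ p, A p * B p = poly8 a₁ a₂ a₃ a₄ a₅ a₆ a₇ a₈ p := by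
      intro p; simp only [poly8]; ring)
    (hg : ∀ p, (nN p * (dA p * dB p) - (3 * nA p * dB p + 3 * nB p * dA p) * dN p) * baseQ p
      * (A p * B p) = k * S p * (dN p * (dA p * dB p)) := by
      intro p; simp only [baseQ, tail8]; push_cast; ring)
    (hw : ∀ p, (A p * B p) ^ 3 - 1728 * N p = S p ^ 2 := by intro p; ring)
    (hV : ∀ p, k ^ 2 * (240 * N p) = pot a₁ a₂ a₃ a₄ a₅ a₆ a₇ a₈ p := by
      intro p; simp only [pot, poly8, tail8, baseQ, baseQTheta, baseV]; ring) :
    Expression.Good ⟨fun p => 1 / (A p ^ (1 / 2 : ℂ) * B p ^ (1 / 2 : ℂ)), c,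
      fun p => N p / (A p ^ 3 * B p ^ 3)⟩ := by
  obtain ⟨hk, hA0, hB0, hN0⟩ := h0
  have hg' : ∀ᶠ p in 𝓝 (0 : ℂ), A p ≠ 0 ∧ B p ≠ 0 ∧ dA p ≠ 0 ∧ dB p ≠ 0 ∧ dN p ≠ 0 :=
    (hA.theta.analytic.continuousAt.eventually_ne (by simp [hA0])).and
      ((hB.theta.analytic.continuousAt.eventually_ne (by simp [hB0])).and
        (hA.eventually_den_ne.and (hB.eventually_den_ne.and hN.eventually_den_ne)))
  -- Here U = AB and x = N/U³, so w(x)U = ((AB)³ - 1728N)/(AB)². Hence M = S/(AB), with S a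
  -- polynomial square root of the numerator.
  refine Expression.good_of hc (hN.div ((hA.pow 3).mul (hB.pow 3)) (by simp [hA0, hB0])) k
    a₁ a₂ a₃ a₄ a₅ a₆ a₇ a₈ (fun p => A p * B p) (fun p => S p / (A p * B p)) hk (by simp [hN0])
    (analyticAt_const.div
      ((hA.theta.analytic.cpow analyticAt_const (by simp [hA0])).mul
        (hB.theta.analytic.cpow analyticAt_const (by simp [hB0]))) (by simp [hA0, hB0]))
    (by simp [hA0, hB0]) hU (fun p hp => ?_) ?_
    (fun p hp => ?_) (fun p hp => ?_)
  · obtain ⟨hA, hB⟩ := mul_ne_zero_iff.1 hp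
    rw [div_pow, mul_pow, cpow_half_sq, cpow_half_sq, one_pow, one_div_mul_cancel hp]
  · refine hg'.mono fun p ⟨h1, h2, h3, h4, h5⟩ => ?_
    push_cast
    field_simp
    linear_combination hg p
  · obtain ⟨hA, hB⟩ := mul_ne_zero_iff.1 hp
    simp only [zero_mul, sub_zero]
    field_simp
    linear_combination hw p
  · obtain ⟨hA, hB⟩ := mul_ne_zero_iff.1 hp
    rw [← hV]
    field_simp
    ring

/-- The criterion for `₃F₂(1/2, 1/4, 3/4; 1, 1; 256 x)`, with `r = 1 / A`, `x = N / A⁴`. -/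
theorem Expression.good_of_pow_four {c : ℕ → ℂ} (hc : IsRec 128 24 0 0 c)
    {A N nA dA nN dN : ℂ → ℂ} (hA : HasLogTheta A nA dA)
    (hN : HasLogTheta N nN dN) (k : ℂ) (a₁ a₂ a₃ a₄ a₅ a₆ a₇ a₈ : ℂ) (S : ℂ → ℂ)
    (h0 : k ≠ 0 ∧ A 0 = 1 ∧ N 0 = 0 := by norm_num)
    (hU : ∀ p, A p ^ 2 = poly8 a₁ a₂ a₃ a₄ a₅ a₆ a₇ a₈ p := by
      intro p; simp only [poly8]; ring)
    (hg : ∀ p, (nN p * dA p - 4 * nA p * dN p) * baseQ p * A p = k * S p * (dN p * dA p) := by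
      intro p; simp only [baseQ, tail8]; push_cast; ring)
    (hw : ∀ p, A p ^ 4 - 256 * N p = S p ^ 2 := by intro p; ring)
    (hV : ∀ p, k ^ 2 * (48 * N p * A p ^ 2) = pot a₁ a₂ a₃ a₄ a₅ a₆ a₇ a₈ p := by
      intro p; simp only [pot, poly8, tail8, baseQ, baseQTheta, baseV]; ring) :
    Expression.Good ⟨fun p => 1 / A p, c, fun p => N p / A p ^ 4⟩ := by
  obtain ⟨hk, hA0, hN0⟩ := h0
  have hg' : ∀ᶠ p in 𝓝 (0 : ℂ), A p ≠ 0 ∧ dA p ≠ 0 ∧ dN p ≠ 0 :=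
    (hA.theta.analytic.continuousAt.eventually_ne (by simp [hA0])).and
      (hA.eventually_den_ne.and hN.eventually_den_ne)
  refine Expression.good_of hc (hN.div (hA.pow 4) (by simp [hA0])) k
    a₁ a₂ a₃ a₄ a₅ a₆ a₇ a₈ (fun p => A p ^ 2) (fun p => S p / A p) hk (by simp [hN0])
    (analyticAt_const.div hA.theta.analytic (by simp [hA0]))
    (by simp [hA0]) hU (fun p hp => ?_) ?_
    (fun p hp => ?_) (fun p hp => ?_)
  · have hA := (pow_ne_zero_iff two_ne_zero).1 hp
    field_simp
  · refine hg'.mono fun p ⟨h1, h2, h3⟩ => ?_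
    push_cast
    field_simp
    linear_combination hg p
  · have hA := (pow_ne_zero_iff two_ne_zero).1 hp
    simp only [zero_mul, sub_zero]
    field_simp
    linear_combination hw p
  · have hA := (pow_ne_zero_iff two_ne_zero).1 hp
    rw [← hV]
    field_simp
    ring

/-- The criterion for `₃F₂(1/2, 1/3, 2/3; 1, 1; 108 x)`, with `r = 1 / A²`, `x = N / A⁶`. -/
theorem Expression.good_of_pow_six {c : ℕ → ℂ} (hc : IsRec 54 12 0 0 c)
    {A N nA dA nN dN : ℂ → ℂ} (hA : HasLogTheta A nA dA)
    (hN : HasLogTheta N nN dN) (k : ℂ) (a₁ a₂ a₃ a₄ a₅ a₆ a₇ a₈ : ℂ) (S : ℂ → ℂ)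
    (h0 : k ≠ 0 ∧ A 0 = 1 ∧ N 0 = 0 := by norm_num)
    (hU : ∀ p, A p ^ 4 = poly8 a₁ a₂ a₃ a₄ a₅ a₆ a₇ a₈ p := by
      intro p; simp only [poly8]; ring)
    (hg : ∀ p, (nN p * dA p - 6 * nA p * dN p) * baseQ p * A p = k * S p * (dN p * dA p) := by
      intro p; simp only [baseQ, tail8]; push_cast; ring)
    (hw : ∀ p, A p ^ 6 - 108 * N p = S p ^ 2 := by intro p; ring)
    (hV : ∀ p, k ^ 2 * (24 * N p * A p ^ 6) = pot a₁ a₂ a₃ a₄ a₅ a₆ a₇ a₈ p := by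
      intro p; simp only [pot, poly8, tail8, baseQ, baseQTheta, baseV]; ring) :
    Expression.Good ⟨fun p => 1 / A p ^ 2, c, fun p => N p / A p ^ 6⟩ := by
  obtain ⟨hk, hA0, hN0⟩ := h0
  have hg' : ∀ᶠ p in 𝓝 (0 : ℂ), A p ≠ 0 ∧ dA p ≠ 0 ∧ dN p ≠ 0 :=
    (hA.theta.analytic.continuousAt.eventually_ne (by simp [hA0])).and
      (hA.eventually_den_ne.and hN.eventually_den_ne)
  -- With U = A⁴ one has w(x)U = (A⁶ - 108N)/A², whence M = S/A.
  refine Expression.good_of hc (hN.div (hA.pow 6) (by simp [hA0])) k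
    a₁ a₂ a₃ a₄ a₅ a₆ a₇ a₈ (fun p => A p ^ 4) (fun p => S p / A p) hk (by simp [hN0])
    (analyticAt_const.div (hA.theta.analytic.pow 2) (by simp [hA0]))
    (by simp [hA0]) hU (fun p hp => ?_) ?_
    (fun p hp => ?_) (fun p hp => ?_)
  · have hA := (pow_ne_zero_iff four_ne_zero).1 hp
    field_simp
  · refine hg'.mono fun p ⟨h1, h2, h3⟩ => ?_
    push_cast
    field_simp
    linear_combination hg p
  · have hA := (pow_ne_zero_iff four_ne_zero).1 hp
    simp only [zero_mul, sub_zero]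
    field_simp
    linear_combination hw p
  · have hA := (pow_ne_zero_iff four_ne_zero).1 hp
    rw [← hV]
    field_simp
    ring

/-- The criterion for `₃F₂(1/2, 1/2, 1/2; 1, 1; 64 x)`, with `r² = 1 / D`, `x = N / D`. -/
theorem Expression.good_of_sq {c : ℕ → ℂ} (hc : IsRec 32 8 0 0 c)
    {r D N nD dD nN dN : ℂ → ℂ} (hD : HasLogTheta D nD dD)
    (hN : HasLogTheta N nN dN) (k : ℂ) (a₁ a₂ a₃ a₄ a₅ a₆ a₇ a₈ : ℂ) (S : ℂ → ℂ)
    (h0 : k ≠ 0 ∧ D 0 = 1 ∧ N 0 = 0 ∧ r 0 = 1 := by norm_num) (hr : AnalyticAt ℂ r 0)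
    (hrD : ∀ p, D p ≠ 0 → r p ^ 2 * D p = 1)
    (hU : ∀ p, D p = poly8 a₁ a₂ a₃ a₄ a₅ a₆ a₇ a₈ p := by
      intro p; simp only [poly8]; ring)
    (hg : ∀ p, (nN p * dD p - nD p * dN p) * baseQ p = k * S p * (dN p * dD p) := by
      intro p; simp only [baseQ, tail8]; push_cast; ring)
    (hw : ∀ p, D p - 64 * N p = S p ^ 2 := by intro p; ring)
    (hV : ∀ p, k ^ 2 * (16 * N p * D p ^ 2) = pot a₁ a₂ a₃ a₄ a₅ a₆ a₇ a₈ p := by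
      intro p; simp only [pot, poly8, tail8, baseQ, baseQTheta, baseV]; ring) :
    Expression.Good ⟨r, c, fun p => N p / D p⟩ := by
  obtain ⟨hk, hD0, hN0, hr0⟩ := h0
  have hg' : ∀ᶠ p in 𝓝 (0 : ℂ), D p ≠ 0 ∧ dD p ≠ 0 ∧ dN p ≠ 0 :=
    (hD.theta.analytic.continuousAt.eventually_ne (by simp [hD0])).and
      (hD.eventually_den_ne.and hN.eventually_den_ne)
  refine Expression.good_of hc (hN.div hD (by simp [hD0])) k
    a₁ a₂ a₃ a₄ a₅ a₆ a₇ a₈ D S hk (by simp [hN0]) hr hr0 hU hrD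
    ?_
    (fun p hp => ?_) (fun p hp => ?_)
  · refine hg'.mono fun p ⟨h1, h2, h3⟩ => ?_
    field_simp
    linear_combination hg p
  · simp only [zero_mul, sub_zero]
    field_simp
    linear_combination hw p
  · rw [← hV]
    field_simp
    ring

/-- The criterion with `r = 1 / A`, `x = N / A²`. -/
theorem Expression.good_of_aperyF {a b e f : ℂ} {c : ℕ → ℂ} (hc : IsRec a b e f c)
    {A D N nA dA nN dN : ℂ → ℂ} (hA : HasLogTheta A nA dA)
    (hN : HasLogTheta N nN dN) (k : ℂ) (a₁ a₂ a₃ a₄ a₅ a₆ a₇ a₈ : ℂ) (S : ℂ → ℂ)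
    (h0 : k ≠ 0 ∧ A 0 = 1 ∧ N 0 = 0 := by norm_num) (hD : ∀ p, D p = A p ^ 2 := by intro p; ring)
    (hU : ∀ p, A p ^ 2 = poly8 a₁ a₂ a₃ a₄ a₅ a₆ a₇ a₈ p := by
      intro p; simp only [poly8]; ring)
    (hg : ∀ p, (nN p * dA p - 2 * nA p * dN p) * baseQ p * A p = k * S p * (dN p * dA p) := by
      intro p; simp only [baseQ, tail8]; push_cast; ring)
    (hw : ∀ p, A p ^ 4 - 2 * a * (N p * A p ^ 2) - e * N p ^ 2 = S p ^ 2 := by intro p; ring)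
    (hV : ∀ p, k ^ 2 * (2 * b * (N p * A p ^ 4) + (e + f) * (N p ^ 2 * A p ^ 2))
      = pot a₁ a₂ a₃ a₄ a₅ a₆ a₇ a₈ p := by
      intro p; simp only [pot, poly8, tail8, baseQ, baseQTheta, baseV]; ring) :
    Expression.Good ⟨fun p => 1 / A p, c, fun p => N p / D p⟩ := by
  obtain ⟨hk, hA0, hN0⟩ := h0
  -- For `F6b` the denominator is written as a product of squares, not as the square of a product,
  -- hence the separate D.
  simp only [hD]
  have hg' : ∀ᶠ p in 𝓝 (0 : ℂ), A p ≠ 0 ∧ dA p ≠ 0 ∧ dN p ≠ 0 :=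
    (hA.theta.analytic.continuousAt.eventually_ne (by simp [hA0])).and
      (hA.eventually_den_ne.and hN.eventually_den_ne)
  refine Expression.good_of hc (hN.div (hA.pow 2) (by simp [hA0])) k
    a₁ a₂ a₃ a₄ a₅ a₆ a₇ a₈ (fun p => A p ^ 2) (fun p => S p / A p) hk (by simp [hN0])
    (analyticAt_const.div hA.theta.analytic (by simp [hA0]))
    (by simp [hA0]) hU (fun p hp => ?_) ?_
    (fun p hp => ?_) (fun p hp => ?_)
  · have hA := (pow_ne_zero_iff two_ne_zero).1 hp
    field_simp
  · refine hg'.mono fun p ⟨h1, h2, h3⟩ => ?_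
    push_cast
    field_simp
    linear_combination hg p
  · have hA := (pow_ne_zero_iff two_ne_zero).1 hp
    field_simp
    linear_combination hw p
  · have hA := (pow_ne_zero_iff two_ne_zero).1 hp
    rw [← hV]
    field_simp

/-- The criterion with `r = 1 / A`, `x = N / A`. -/
theorem Expression.good_of_aperyG {a b e : ℂ} {c : ℕ → ℂ} (hc : IsRec a b e 0 c)
    {A N nA dA nN dN : ℂ → ℂ} (hA : HasLogTheta A nA dA)
    (hN : HasLogTheta N nN dN) (k : ℂ) (a₁ a₂ a₃ a₄ a₅ a₆ a₇ a₈ : ℂ) (S : ℂ → ℂ)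
    (h0 : k ≠ 0 ∧ A 0 = 1 ∧ N 0 = 0 := by norm_num)
    (hU : ∀ p, A p ^ 2 = poly8 a₁ a₂ a₃ a₄ a₅ a₆ a₇ a₈ p := by
      intro p; simp only [poly8]; ring)
    (hg : ∀ p, (nN p * dA p - nA p * dN p) * baseQ p = k * S p * (dN p * dA p) := by
      intro p; simp only [baseQ, tail8]; push_cast; ring)
    (hw : ∀ p, A p ^ 2 - 2 * a * (N p * A p) - e * N p ^ 2 = S p ^ 2 := by intro p; ring)
    (hV : ∀ p, k ^ 2 * (2 * b * (N p * A p ^ 5) + e * (N p ^ 2 * A p ^ 4))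
      = pot a₁ a₂ a₃ a₄ a₅ a₆ a₇ a₈ p := by
      intro p; simp only [pot, poly8, tail8, baseQ, baseQTheta, baseV]; ring) :
    Expression.Good ⟨fun p => 1 / A p, c, fun p => N p / A p⟩ := by
  obtain ⟨hk, hA0, hN0⟩ := h0
  have hg' : ∀ᶠ p in 𝓝 (0 : ℂ), A p ≠ 0 ∧ dA p ≠ 0 ∧ dN p ≠ 0 :=
    (hA.theta.analytic.continuousAt.eventually_ne (by simp [hA0])).and
      (hA.eventually_den_ne.and hN.eventually_den_ne)
  refine Expression.good_of hc (hN.div hA (by simp [hA0])) k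
    a₁ a₂ a₃ a₄ a₅ a₆ a₇ a₈ (fun p => A p ^ 2) S hk (by simp [hN0])
    (analyticAt_const.div hA.theta.analytic (by simp [hA0]))
    (by simp [hA0]) hU (fun p hp => ?_) ?_
    (fun p hp => ?_) (fun p hp => ?_)
  · have hA := (pow_ne_zero_iff two_ne_zero).1 hp
    field_simp
  · refine hg'.mono fun p ⟨h1, h2, h3⟩ => ?_
    field_simp
    linear_combination hg p
  · have hA := (pow_ne_zero_iff two_ne_zero).1 hp
    field_simp
    linear_combination hw p
  · have hA := (pow_ne_zero_iff two_ne_zero).1 hp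
    rw [← hV]
    field_simp
    ring

/-! ### Verification of the forty-two expressions -/

set_option maxHeartbeats 4000000 in
theorem good_of_mem_level1 : ∀ E ∈ level1, E.Good := by
  have h0 := HasLogTheta.ident
  have h1 := hasLogTheta_one_sub
  have h2 := hasLogTheta_one_sub_mul 2
  have h4 := hasLogTheta_one_sub_mul 4
  have h3 := hasLogTheta_one_add_mul 2
  refine List.forall_iff_forall_mem.1 ⟨?_, ?_, ?_, ?_, ?_, ?_, ?_, ?_⟩
  -- In each certificate k is the order of vanishing of x at 0, the eight numbers are the
  -- coefficients of U, and the final polynomial is the square root S normalised by S(0) = 1. The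
  -- default arguments verify the identities.
  · exact Expression.good_of_sqrt_prefactor isRec_coeffF1 (hasLogTheta_poly 4 (-8) 0 0 0 0)
      (hasLogTheta_poly 228 (-408) (-128) (-192) 768 (-512)) ((((h0.mul (h1.pow 3)).mul
      (h4.pow 12)).mul h2).mul (h3.pow 3)) 1 232 496 (-3584) 2560 1024 4096 (-8192) 4096
      (fun p => 1 - 516 * p - 11040 * p ^ 2 + 23648 * p ^ 3 + 68832 * p ^ 4 - 43776 * p ^ 5
      - 597504 * p ^ 6 + 1179648 * p ^ 7 - 737280 * p ^ 8 - 163840 * p ^ 9 + 786432 * p ^ 10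
      - 786432 * p ^ 11 + 262144 * p ^ 12)
  · exact Expression.good_of_sqrt_prefactor isRec_coeffF1 (hasLogTheta_poly (-2) 4 0 0 0 0)
      (hasLogTheta_poly (-6) 240 (-920) 960 (-96) 64) (((((h0.pow 2).mul (h1.pow 6)).mul
      (h4.pow 6)).mul (h2.pow 2)).mul (h3.pow 6)) 2 (-8) 256 (-1424) 3760 (-5696) 4096 (-512)
      256 (fun p => 1 - 12 * p - 456 * p ^ 2 + 5000 * p ^ 3 - 32472 * p ^ 4 + 137664 * p ^ 5
      - 355584 * p ^ 6 + 550656 * p ^ 7 - 519552 * p ^ 8 + 320000 * p ^ 9 - 116736 * p ^ 10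
      - 12288 * p ^ 11 + 4096 * p ^ 12)
  · exact Expression.good_of_sqrt_prefactor isRec_coeffF1 (hasLogTheta_poly 4 (-8) 0 0 0 0)
      (hasLogTheta_poly (-12) 72 (-128) (-192) 768 (-512)) (((((h0.pow 3).mul h1).mul
      (h4.pow 4)).mul (h2.pow 3)).mul h3) 3 (-8) 16 256 (-1280) 1024 4096 (-8192) 4096 (fun p =>
      1 - 12 * p + 48 * p ^ 2 - 544 * p ^ 3 + 4320 * p ^ 4 - 11520 * p ^ 5 - 16896 * p ^ 6
      + 147456 * p ^ 7 - 221184 * p ^ 8 - 163840 * p ^ 9 + 786432 * p ^ 10 - 786432 * p ^ 11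
      + 262144 * p ^ 12)
  · exact Expression.good_of_sqrt_prefactor isRec_coeffF1 (hasLogTheta_poly (-2) (-2) 0 0 0 0)
      (hasLogTheta_poly (-6) 6 16 204 (-456) (-8)) (((((h0.pow 4).mul (h1.pow 12)).mul
      (h4.pow 3)).mul h2).mul (h3.pow 3)) 4 (-8) 16 16 160 (-896) 496 928 16 (fun p => 1
      - 12 * p + 48 * p ^ 2 - 40 * p ^ 3 - 720 * p ^ 4 + 4608 * p ^ 5 - 9336 * p ^ 6
      - 2736 * p ^ 7 + 17208 * p ^ 8 + 23648 * p ^ 9 - 44160 * p ^ 10 - 8256 * p ^ 11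
      + 64 * p ^ 12)
  · exact Expression.good_of_sqrt_prefactor isRec_coeffF1 (hasLogTheta_poly (-2) 4 0 0 0 0)
      (hasLogTheta_poly (-6) 0 40 0 (-96) 64) (((((h0.pow 6).mul (h1.pow 2)).mul (h4.pow 2)).mul
      (h2.pow 6)).mul (h3.pow 2)) 6 (-8) 16 16 (-80) 64 256 (-512) 256 (fun p => 1 - 12 * p
      + 48 * p ^ 2 - 40 * p ^ 3 - 216 * p ^ 4 + 576 * p ^ 5 - 768 * p ^ 6 + 2304 * p ^ 7
      - 3456 * p ^ 8 - 2560 * p ^ 9 + 12288 * p ^ 10 - 12288 * p ^ 11 + 4096 * p ^ 12)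
  · exact Expression.good_of_sqrt_prefactor isRec_coeffF1 (hasLogTheta_poly (-2) (-2) 0 0 0 0)
      (hasLogTheta_poly (-6) 6 16 (-36) 24 (-8)) (((((h0.pow 12).mul (h1.pow 4)).mul h4).mul
      (h2.pow 3)).mul h3) 12 (-8) 16 16 (-80) 64 16 (-32) 16 (fun p => 1 - 12 * p + 48 * p ^ 2
      - 40 * p ^ 3 - 216 * p ^ 4 + 576 * p ^ 5 - 264 * p ^ 6 - 720 * p ^ 7 + 1080 * p ^ 8
      - 544 * p ^ 9 + 192 * p ^ 10 - 192 * p ^ 11 + 64 * p ^ 12)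
  · exact Expression.good_of_sqrt_prefactor isRec_coeffF1 (hasLogTheta_poly (-8) 4 0 0 0 0)
      (hasLogTheta_poly (-240) 1932 (-5888) 7728 (-3840) 64) ((((h0.neg.mul (h1.pow 3)).mul
      (h4.pow 3)).mul (h2.pow 4)).mul (h3.pow 12)) 1 (-248) 3856 (-22304) 62560 (-89216) 61696
      (-15872) 256 (fun p => 1 + 492 * p - 22128 * p ^ 2 + 308912 * p ^ 3 - 2165904 * p ^ 4
      + 8834688 * p ^ 5 - 22273536 * p ^ 6 + 35338752 * p ^ 7 - 34654464 * p ^ 8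
      + 19770368 * p ^ 9 - 5664768 * p ^ 10 + 503808 * p ^ 11 + 4096 * p ^ 12)
  · exact Expression.good_of_sqrt_prefactor isRec_coeffF1 (hasLogTheta_poly (-8) 4 0 0 0 0)
      (hasLogTheta_poly 0 12 (-128) 48 0 64) (((((h0.pow 3).neg.mul h1).mul h4).mul
      (h2.pow 12)).mul (h3.pow 4)) 3 (-8) 16 (-224) 1120 (-896) 256 (-512) 256 (fun p => 1
      - 12 * p + 48 * p ^ 2 + 464 * p ^ 3 - 4752 * p ^ 4 + 12672 * p ^ 5 - 16896 * p ^ 6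
      + 50688 * p ^ 7 - 76032 * p ^ 8 + 29696 * p ^ 9 + 12288 * p ^ 10 - 12288 * p ^ 11
      + 4096 * p ^ 12)

set_option maxHeartbeats 4000000 in
theorem good_of_mem_level2 : ∀ E ∈ level2, E.Good := by
  have h0 := HasLogTheta.ident
  have h1 := hasLogTheta_one_sub
  have h2 := hasLogTheta_one_sub_mul 2
  have h4 := hasLogTheta_one_sub_mul 4
  have h3 := hasLogTheta_one_add_mul 2
  refine List.forall_iff_forall_mem.1 ⟨?_, ?_, ?_, ?_, ?_, ?_⟩
  · exact Expression.good_of_pow_four isRec_coeffF2 (hasLogTheta_poly 20 (-48) 32 (-32) 0 0)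
      ((((h0.mul (h1.pow 3)).mul (h4.pow 6)).mul h2).mul (h3.pow 3)) 1 40 304 (-1856) 3520
      (-4352) 4096 (-2048) 1024 (fun p => 1 - 88 * p + 176 * p ^ 2 - 704 * p ^ 3 + 4160 * p ^ 4
      - 7936 * p ^ 5 + 4096 * p ^ 6 + 2048 * p ^ 7 - 1024 * p ^ 8)
  · exact Expression.good_of_pow_four isRec_coeffF2 (hasLogTheta_poly (-4) 24 (-40) (-8) 0 0)
      (((((h0.pow 2).mul (h1.pow 6)).mul (h4.pow 3)).mul h2).mul (h3.pow 3)) 2 (-8) 64 (-272)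
      880 (-1856) 1216 640 64 (fun p => 1 - 8 * p - 64 * p ^ 2 + 496 * p ^ 3 - 1040 * p ^ 4
      + 704 * p ^ 5 - 704 * p ^ 6 + 1408 * p ^ 7 - 64 * p ^ 8)
  · exact Expression.good_of_pow_four isRec_coeffF2 (hasLogTheta_poly (-4) 0 32 (-32) 0 0)
      (((((h0.pow 3).mul h1).mul (h4.pow 2)).mul (h2.pow 3)).mul h3) 3 (-8) 16 64 (-320) 256
      1024 (-2048) 1024 (fun p => 1 - 8 * p + 16 * p ^ 2 - 64 * p ^ 3 + 320 * p ^ 4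
      - 256 * p ^ 5 - 1024 * p ^ 6 + 2048 * p ^ 7 - 1024 * p ^ 8)
  · exact Expression.good_of_pow_four isRec_coeffF2 (hasLogTheta_poly (-4) 0 8 (-8) 0 0)
      (((((h0.pow 6).mul (h1.pow 2)).mul h4).mul (h2.pow 3)).mul h3) 6 (-8) 16 16 (-80) 64 64
      (-128) 64 (fun p => 1 - 8 * p + 16 * p ^ 2 + 16 * p ^ 3 - 80 * p ^ 4 + 64 * p ^ 5
      - 64 * p ^ 6 + 128 * p ^ 7 - 64 * p ^ 8)
  · exact Expression.good_of_pow_four isRec_coeffF2 (hasLogTheta_poly (-28) 96 (-112) 16 0 0)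
      (((((h0.mul (h1.pow 3)).mul (h4.pow 3)).mul (h2.pow 2)).mul (h3.pow 6))).neg 1 (-56) 976
      (-5600) 15520 (-22400) 15616 (-3584) 256 (fun p => 1 + 72 * p - 944 * p ^ 2 + 5536 * p ^ 3
      - 15840 * p ^ 4 + 22144 * p ^ 5 - 15104 * p ^ 6 + 4608 * p ^ 7 + 256 * p ^ 8)
  · exact Expression.good_of_pow_four isRec_coeffF2 (hasLogTheta_poly (-4) 0 (-16) 16 0 0)
      ((((((h0.pow 3).mul h1).mul h4).mul (h2.pow 6)).mul (h3.pow 2))).neg 3 (-8) 16 (-32) 160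
      (-128) 256 (-512) 256 (fun p => 1 - 8 * p + 16 * p ^ 2 + 96 * p ^ 3 - 480 * p ^ 4
      + 384 * p ^ 5 + 256 * p ^ 6 - 512 * p ^ 7 + 256 * p ^ 8)

set_option maxHeartbeats 4000000 in
theorem good_of_mem_level3 : ∀ E ∈ level3, E.Good := by
  have h0 := HasLogTheta.ident
  have h1 := hasLogTheta_one_sub
  have h2 := hasLogTheta_one_sub_mul 2
  have h4 := hasLogTheta_one_sub_mul 4
  have h3 := hasLogTheta_one_add_mul 2
  refine List.forall_iff_forall_mem.1 ⟨?_, ?_, ?_, ?_⟩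
  · exact Expression.good_of_pow_six isRec_coeffF3 (hasLogTheta_poly 4 (-8) 0 0 0 0) (((h0.mul
      h1).mul (h4.pow 4)).mul (hasLogTheta_poly 0 (-4) 0 0 0 0)) 1 16 64 (-128) (-896) 1024 4096
      (-8192) 4096 (fun p => 1 - 42 * p + 132 * p ^ 2 - 128 * p ^ 3 - 192 * p ^ 4 + 768 * p ^ 5
      - 512 * p ^ 6)
  · exact Expression.good_of_pow_six isRec_coeffF3 (hasLogTheta_poly (-2) 4 0 0 0 0)
      ((((h0.pow 2).mul (h1.pow 2)).mul (h4.pow 2)).mul ((hasLogTheta_poly 0 (-4) 0 0 0 0).pow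
      2)) 2 (-8) 40 (-128) 304 (-512) 640 (-512) 256 (fun p => 1 - 6 * p - 30 * p ^ 2
      + 160 * p ^ 3 - 120 * p ^ 4 - 96 * p ^ 5 + 64 * p ^ 6)
  · exact Expression.good_of_pow_six isRec_coeffF3 (hasLogTheta_poly (-2) (-2) 0 0 0 0)
      ((((h0.pow 4).mul (h1.pow 4)).mul h4).mul (hasLogTheta_poly 0 (-4) 0 0 0 0)) 4 (-8) 16 16
      (-56) (-32) 64 64 16 (fun p => 1 - 6 * p + 6 * p ^ 2 + 16 * p ^ 3 - 66 * p ^ 4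
      + 84 * p ^ 5 - 8 * p ^ 6)
  · exact Expression.good_of_pow_six isRec_coeffF3 (hasLogTheta_poly (-8) 4 0 0 0 0) ((((h0.mul
      h1).mul h4).mul ((hasLogTheta_poly 0 (-4) 0 0 0 0).pow 4))).neg 1 (-32) 400 (-2432) 7264
      (-9728) 6400 (-2048) 256 (fun p => 1 + 30 * p - 228 * p ^ 2 + 592 * p ^ 3 - 912 * p ^ 4
      + 480 * p ^ 5 + 64 * p ^ 6)

set_option maxHeartbeats 4000000 in
theorem good_of_mem_level4 : ∀ E ∈ level4, E.Good := by
  have h0 := HasLogTheta.ident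
  have h1 := hasLogTheta_one_sub
  have h2 := hasLogTheta_one_sub_mul 2
  have h4 := hasLogTheta_one_sub_mul 4
  have h3 := hasLogTheta_one_add_mul 2
  refine List.forall_iff_forall_mem.1 ⟨?_, ?_, ?_, ?_, ?_, ?_⟩
  -- The six polynomials S at this level are the six denominators of the level 2 prefactors.
  · exact Expression.good_of_sq isRec_coeffF4 ((h2.pow 2).mul (h3.pow 6)) ((h0.mul
      (h1.pow 3)).mul (h4.pow 3)) 1 8 16 (-32) (-160) (-128) 256 512 256 (fun p => 1 - 28 * p
      + 96 * p ^ 2 - 112 * p ^ 3 + 16 * p ^ 4) (by norm_num) (by fun_prop (disch := simp))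
      fun p hp => one_div_sq_mul (by ring) hp
  · exact Expression.good_of_sq isRec_coeffF4 ((h2.pow 6).mul (h3.pow 2)) (((h0.pow 3).mul
      h1).mul h4) 3 (-8) 16 32 (-160) 128 256 (-512) 256 (fun p => 1 - 4 * p - 16 * p ^ 3
      + 16 * p ^ 4) (by norm_num) (by fun_prop (disch := simp)) fun p hp => one_div_sq_mul
      (by ring) hp
  · exact Expression.good_of_sq isRec_coeffF4 (h4.pow 6) ((((h0.mul h2).mul (h3.pow 3)).mul
      (h1.pow 3))).neg 1 (-24) 240 (-1280) 3840 (-6144) 4096 0 0 (fun p => 1 + 20 * p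
      - 48 * p ^ 2 + 32 * p ^ 3 - 32 * p ^ 4) (by norm_num) (by fun_prop (disch := simp))
      fun p hp => one_div_sq_mul (by ring) hp
  · exact Expression.good_of_sq isRec_coeffF4 (h4.pow 2) (((((h0.pow 3).mul (h2.pow 3)).mul
      h3).mul h1)).neg 3 (-8) 16 0 0 0 0 0 0 (fun p => 1 - 4 * p + 32 * p ^ 3 - 32 * p ^ 4)
      (by norm_num) (by fun_prop (disch := simp)) fun p hp => one_div_sq_mul (by ring) hp
  · refine Expression.good_of_sq isRec_coeffF4 ((h2.mul (h3.pow 3)).mul (h4.pow 3))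
      (((h0.pow 2).mul (h1.pow 6))).neg 2 (-8) 0 112 (-80) (-576) 256 1024 0 (fun p => 1 - 4 * p
      + 24 * p ^ 2 - 40 * p ^ 3 - 8 * p ^ 4) (by norm_num) ?_ fun p hp => ?_
    -- Each base equals 1 at p = 0, inside the slit plane, so the principal powers are analytic
    -- there.
    · exact analyticAt_const.div (((h2.theta.analytic.cpow analyticAt_const (by simp)).mul
        (h3.theta.analytic.cpow analyticAt_const (by simp))).mul
        (h4.theta.analytic.cpow analyticAt_const (by simp))) (by simp)
    · simp only [div_pow, mul_pow, cpow_half_sq, cpow_three_half_sq, one_pow]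
      exact one_div_mul_cancel hp
  · refine Expression.good_of_sq isRec_coeffF4 (((h2.pow 3).mul h3).mul h4) (((h0.pow 6).mul
      (h1.pow 2))).neg 6 (-8) 16 16 (-80) 64 0 0 0 (fun p => 1 - 4 * p + 8 * p ^ 3 - 8 * p ^ 4)
      (by norm_num) ?_ fun p hp => ?_
    · exact analyticAt_const.div (((h2.theta.analytic.cpow analyticAt_const (by simp)).mul
        (h3.theta.analytic.cpow analyticAt_const (by simp))).mul
        (h4.theta.analytic.cpow analyticAt_const (by simp))) (by simp)
    · simp only [div_pow, mul_pow, cpow_half_sq, cpow_three_half_sq, one_pow]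
      exact one_div_mul_cancel hp

set_option maxHeartbeats 4000000 in
theorem good_of_mem_level6F : ∀ E ∈ level6F, E.Good := by
  have h0 := HasLogTheta.ident
  have h1 := hasLogTheta_one_sub
  have h2 := hasLogTheta_one_sub_mul 2
  have h4 := hasLogTheta_one_sub_mul 4
  have h3 := hasLogTheta_one_add_mul 2
  refine List.forall_iff_forall_mem.1 ⟨?_, ?_, ?_, ?_, ?_, ?_, ?_, ?_, ?_⟩
  · exact Expression.good_of_aperyF isRec_coeffF6a (hasLogTheta_poly (-16) 24 32 (-32) 0 0)
      ((((h0.mul h1).mul (h4.pow 2)).mul h2).mul h3) 1 (-32) 304 (-704) (-512) 2560 (-512)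
      (-2048) 1024 (fun p => 1 + 2 * p - 4 * p ^ 2 + 16 * p ^ 3 - 160 * p ^ 4 + 704 * p ^ 5
      - 1664 * p ^ 6 + 2048 * p ^ 7 - 1024 * p ^ 8)
  · exact Expression.good_of_aperyF isRec_coeffF6a (hasLogTheta_poly (-4) (-12) 32 (-8) 0 0)
      (((((h0.pow 2).mul (h1.pow 2)).mul h4).mul h2).mul h3) 2 (-8) (-8) 160 (-128) (-704) 1216
      (-512) 64 (fun p => 1 - 8 * p + 26 * p ^ 2 - 44 * p ^ 3 + 40 * p ^ 4 - 16 * p ^ 5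
      + 16 * p ^ 6 - 32 * p ^ 7 - 64 * p ^ 8)
  · exact Expression.good_of_aperyF isRec_coeffF6a (hasLogTheta_poly 8 (-48) 32 16 0 0)
      ((((h0.neg.mul h1).mul h4).mul (h2.pow 2)).mul (h3.pow 2)) 1 16 (-32) (-704) 2848 (-2816)
      (-512) 1024 256 (fun p => 1 - 18 * p + 136 * p ^ 2 - 584 * p ^ 3 + 1440 * p ^ 4
      - 2336 * p ^ 5 + 2176 * p ^ 6 - 1152 * p ^ 7 + 256 * p ^ 8)
  · exact Expression.good_of_aperyF isRec_coeffF6b ((hasLogTheta_poly (-2) 4 0 0 0 0).mul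
      (hasLogTheta_poly 4 (-8) 0 0 0 0)) ((((h0.mul h1).mul (h4.pow 2)).mul h2).mul h3) 1 4
      (-20) 16 208 (-896) 1792 (-2048) 1024 (fun p => 1 - 16 * p + 32 * p ^ 2 - 128 * p ^ 3
      + 704 * p ^ 4 - 1024 * p ^ 5 - 512 * p ^ 6 + 2048 * p ^ 7 - 1024 * p ^ 8)
  · exact Expression.good_of_aperyF isRec_coeffF6b ((hasLogTheta_poly (-2) (-2) 0 0 0 0).mul
      (hasLogTheta_poly (-2) 4 0 0 0 0)) (((((h0.pow 2).mul (h1.pow 2)).mul h4).mul h2).mul h3)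
      2 (-8) 28 (-56) 52 16 (-80) 64 64 (fun p => 1 - 8 * p + 8 * p ^ 2 + 64 * p ^ 3
      - 176 * p ^ 4 + 128 * p ^ 5 - 128 * p ^ 6 + 256 * p ^ 7 - 64 * p ^ 8)
  · exact Expression.good_of_aperyF isRec_coeffF6b ((hasLogTheta_poly (-2) 4 0 0 0 0).mul
      (hasLogTheta_poly (-8) 4 0 0 0 0)) ((((h0.neg.mul h1).mul h4).mul (h2.pow 2)).mul
      (h3.pow 2)) 1 (-20) 148 (-560) 1408 (-2240) 2368 (-1280) 256 (fun p => 1 - 80 * p ^ 2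
      + 640 * p ^ 3 - 2016 * p ^ 4 + 2560 * p ^ 5 - 1280 * p ^ 6 + 256 * p ^ 8)
  · exact Expression.good_of_aperyF isRec_coeffF6c (hasLogTheta_poly 0 8 (-32) 32 0 0)
      ((((h0.mul h1).mul (h4.pow 2)).mul h2).mul h3) 1 0 16 (-64) 128 (-512) 1536 (-2048) 1024
      (fun p => 1 - 14 * p - 20 * p ^ 2 + 304 * p ^ 3 - 800 * p ^ 4 + 832 * p ^ 5 + 640 * p ^ 6
      - 2048 * p ^ 7 + 1024 * p ^ 8)
  · exact Expression.good_of_aperyF isRec_coeffF6c (hasLogTheta_poly (-4) 4 0 8 0 0)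
      (((((h0.pow 2).mul (h1.pow 2)).mul h4).mul h2).mul h3) 2 (-8) 24 (-32) 32 (-64) 64 0 64
      (fun p => 1 - 8 * p + 10 * p ^ 2 + 52 * p ^ 3 - 200 * p ^ 4 + 304 * p ^ 5 - 80 * p ^ 6
      - 224 * p ^ 7 + 64 * p ^ 8)
  · exact Expression.good_of_aperyF isRec_coeffF6c (hasLogTheta_poly (-8) 32 (-32) 16 0 0)
      ((((h0.neg.mul h1).mul h4).mul (h2.pow 2)).mul (h3.pow 2)) 1 (-16) 128 (-576) 1568 (-2304)
      2048 (-1024) 256 (fun p => 1 - 2 * p - 104 * p ^ 2 + 664 * p ^ 3 - 1760 * p ^ 4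
      + 2656 * p ^ 5 - 1664 * p ^ 6 - 128 * p ^ 7 + 256 * p ^ 8)

set_option maxHeartbeats 4000000 in
theorem good_of_mem_level6G : ∀ E ∈ level6G, E.Good := by
  have h0 := HasLogTheta.ident
  have h1 := hasLogTheta_one_sub
  have h2 := hasLogTheta_one_sub_mul 2
  have h4 := hasLogTheta_one_sub_mul 4
  have h3 := hasLogTheta_one_add_mul 2
  refine List.forall_iff_forall_mem.1 ⟨?_, ?_, ?_, ?_, ?_, ?_, ?_, ?_, ?_⟩
  -- The nine polynomials S for the functions G are, in order, the denominators of the nine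
  -- prefactors for the functions F.
  · exact Expression.good_of_aperyG isRec_coeffG6a (h3.mul h1) ((h0.mul (h4.pow 2)).mul h2) 1 2
      (-3) (-4) 4 0 0 0 0 (fun p => 1 - 16 * p + 24 * p ^ 2 + 32 * p ^ 3 - 32 * p ^ 4)
  · exact Expression.good_of_aperyG isRec_coeffG6a (h2.mul (h1.pow 2)) (((h0.pow 2).mul h3).mul
      h4) 2 (-8) 26 (-44) 41 (-20) 4 0 0 (fun p => 1 - 4 * p - 12 * p ^ 2 + 32 * p ^ 3
      - 8 * p ^ 4)
  · exact Expression.good_of_aperyG isRec_coeffG6a ((h1.mul h4).mul (h2.pow 2)) (h0.neg.mul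
      (h3.pow 2)) 1 (-18) 137 (-576) 1464 (-2304) 2192 (-1152) 256 (fun p => 1 + 8 * p
      - 48 * p ^ 2 + 32 * p ^ 3 + 16 * p ^ 4)
  · exact Expression.good_of_aperyG isRec_coeffG6b (h4.pow 2) (((h0.mul h3).mul h2).mul h1) 1
      (-16) 96 (-256) 256 0 0 0 0 (fun p => 1 + 2 * p - 12 * p ^ 2 + 32 * p ^ 3 - 32 * p ^ 4)
  · exact Expression.good_of_aperyG isRec_coeffG6b ((h2.mul h3).mul h4) ((h0.pow 2).mul
      (h1.pow 2)) 2 (-8) 8 64 (-112) (-128) 256 0 0 (fun p => 1 - 4 * p + 6 * p ^ 2 - 4 * p ^ 3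
      - 8 * p ^ 4)
  · exact Expression.good_of_aperyG isRec_coeffG6b ((h2.pow 2).mul (h3.pow 2)) ((h0.neg.mul
      h1).mul h4) 1 0 (-16) 0 96 0 (-256) 0 256 (fun p => 1 - 10 * p + 24 * p ^ 2 - 40 * p ^ 3
      + 16 * p ^ 4)
  · exact Expression.good_of_aperyG isRec_coeffG6c ((h1.mul h3).mul (h4.pow 2)) (h0.mul h2) 1
      (-14) 61 (-20) (-476) 832 640 (-2048) 1024 (fun p => 1 + 8 * p ^ 2 - 32 * p ^ 3
      + 32 * p ^ 4)
  · exact Expression.good_of_aperyG isRec_coeffG6c ((h3.mul (h1.pow 2)).mul h4) ((h0.pow 2).mul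
      h2) 2 (-8) 10 52 (-119) (-20) 244 (-224) 64 (fun p => 1 - 4 * p + 4 * p ^ 2 + 8 * p ^ 4)
  · exact Expression.good_of_aperyG isRec_coeffG6c ((h1.mul h4).mul (h3.pow 2)) (h0.neg.mul
      (h2.pow 2)) 1 (-2) (-23) 16 184 64 (-368) (-128) 256 (fun p => 1 - 8 * p + 32 * p ^ 2
      - 32 * p ^ 3 + 16 * p ^ 4)

theorem good_of_mem_fortyTwo (E : Expression) (hE : E ∈ fortyTwo) : E.Good := by
  simp only [fortyTwo, List.mem_append] at hE
  obtain ((((h | h) | h) | h) | h) | h := hE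
  · exact good_of_mem_level1 E h
  · exact good_of_mem_level2 E h
  · exact good_of_mem_level3 E h
  · exact good_of_mem_level4 E h
  · exact good_of_mem_level6F E h
  · exact good_of_mem_level6G E h

end

end FortyTwo

/-- For all complex `p` near `0`, the series in the forty-two expressions all converge and the
forty-two expressions have equal values. -/
theorem mainTheorem1 :
    ∀ᶠ p in nhds (0 : ℂ),
      (∀ e ∈ FortyTwo.fortyTwo, e.Converges p) ∧
        ∀ e₁ ∈ FortyTwo.fortyTwo, ∀ e₂ ∈ FortyTwo.fortyTwo, e₁.value p = e₂.value p := by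
  -- Finiteness of the list allows one neighbourhood of 0 to serve all expressions and all pairs.
  have hfin := FortyTwo.fortyTwo.finite_toSet
  refine Filter.Eventually.and ?_ ?_
  · exact (Filter.eventually_all_finite hfin).2
      fun e he => (FortyTwo.good_of_mem_fortyTwo e he).2
  · exact (Filter.eventually_all_finite hfin).2 fun e₁ h₁ =>
      (Filter.eventually_all_finite hfin).2 fun e₂ h₂ =>
        (FortyTwo.good_of_mem_fortyTwo e₁ h₁).eventually_eq
          (FortyTwo.good_of_mem_fortyTwo e₂ h₂)
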